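/- **Games.** For $d\ge 1$ let $\mathcal H=\mathbb C^d$; a pure state is given by a unit vector $\psi\in\mathcal H$. In a zero-sum game with payoff $P(\chi,\xi)$ to player I and $-P(\chi,\xi)$ to player II, mixed strategies are probability measures on the pure strategies, and $P$ is extended to them by expectation. A pair $(\chi^*,\xi^*)$ is a Nash equilibrium if $P(\chi,\xi^*)\le P(\chi^*,\xi^*)\le P(\chi^*,\xi)$ for all mixed $\chi,\xi$; the value of the game is the common number $\sup_\chi\inf_\xi P(\chi,\xi)=\inf_\xi\sup_\chi P(\chi,\xi)$. The SWAP test on $\rho\otimes\sigma$ measures the projection $\frac12(1+\mathrm{SWAP})$; player I receives $1$ if the test is passed and $-1$ otherwise. *State estimation game ($N$ copies).* Player II chooses a pure state $\psi$. Player I chooses a POVM $(E_r)$ on $\mathcal H^{\otimes N}$ with finitely many outcomes, and a pure state $\phi_r$ for each outcome. The referee applies the SWAP test to $\sum_r \mathrm{tr}\big(E_r(|\psi\rangle\langle\psi|)^{\otimes N}\big)|\phi_r\rangle\langle\phi_r|$ and $|\psi\rangle\langle\psi|$. *Cloning game ($N\mapsto M$, $N\le M$).* Player II chooses a pure state $\psi$.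 Player I chooses a completely positive trace-preserving map $T$ from operators on $\mathcal H^{\otimes N}$ to operators on $\mathcal H^{\otimes M}$. The referee applies the SWAP test to $T\big((|\psi\rangle\langle\psi|)^{\otimes N}\big)$ and $(|\psi\rangle\langle\psi|)^{\otimes M}$. In both games let $\xi^*$ be player II's mixed strategy of playing $U\psi_0$ with $U$ distributed according to the Haar probability measure of the unitary group $U(d)$, where $\psi_0$ is any fixed unit vector. **Theorem.** (a) Let $d=2$ and let $N\geq 0$. For $m\in\{-\frac N2,-\frac N2+1,\dots,\frac N2\}$ let $|m\rangle=|\frac N2,m\rangle\in(\mathbb C^2)^{\otimes N}$ be the symmetric spin-$\frac N2$ basis states and let $d^{N/2}_{m,N/2}(\theta)=\binom{N}{N/2-m}^{1/2}\cos^{N/2+m}(\tfrac\theta2)\,\sin^{N/2-m}(\tfrac\theta2)$. There are a finite $R$, numbers $c_r\ge0$, angles $\psi_r,\theta_r\in\mathbb R$ and qubit pure states $\phi_r$ ($1\le r\le R$) such that $$\sum_{r=1}^R c_r e^{-i\psi_r(m-n)}d^{N/2}_{m,N/2}(\theta_r)\,d^{N/2}_{n,N/2}(\theta_r)=\delta_{m,n}\quad\text{for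 all } m,n,\qquad |\phi_r\rangle^{\otimes N}=\sum_m e^{-i\psi_r m}d^{N/2}_{m,N/2}(\theta_r)|m\rangle .$$ For any such data let player I measure the POVM with elements $$E_r=\sum_{m,n}c_re^{-i\psi_r(m-n)}d^{N/2}_{m,N/2}(\theta_r)\,d^{N/2}_{n,N/2}(\theta_r)\,|m\rangle\langle n|,\qquad 1\le r\le R,$$ completed by one further element $1-\sum_rE_r$ (which has probability $0$ on $N$ identical copies, and on which any state may be submitted), and submit $\phi_r$ on outcome $r$. Let $\chi^*$ be the mixed strategy in which the axes are rotated by a Haar-random $U\in U(2)$, that is, all POVM elements $E$ are replaced by $U^{\otimes N}E(U^{\otimes N})^\dagger$ and all submitted states $\phi$ by $U\phi$. Then $(\chi^*,\xi^*)$ is a Nash equilibrium of the state estimation game, $P(\chi^*,\xi^*)=\frac{N+1}{N+2}$, and this is the value of the game. (b) Let $d\ge1$ and $0\le N\le M$, let $d[N]=\binom{d+N-1}{N}$, and let $s_M$ be the orthogonal projection of $\mathcal H^{\otimes M}$ onto its Bose (permutation-symmetric) subspace. There is a completely positive trace-preserving map $T$ with $$T(\rho)=\frac{d[N]}{d[M]}\,s_M\big(\rho\otimes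 \mathbf 1^{\otimes(M-N)}\big)s_M\qquad\text{for all operators }\rho=s_N\rho s_N ,$$ and for every such $T$, if $\chi^*$ is the strategy of using $T$ with certainty, then $(\chi^*,\xi^*)$ is a Nash equilibrium of the cloning game, $P(\chi^*,\xi^*)=\frac{d[N]}{d[M]}$, and this is the value of the game. -/

import Mathlib

open MeasureTheory
open scoped Matrix ComplexOrder Kronecker

noncomputable section

namespace QuantumGames

/-! ### Two-player games -/

section Games

variable {A B : Type*}

/-- The best replies of player I to the strategy `ξ` of player II; `P₁` is the payoff of I. -/
def bestRepliesI (P₁ : A → B → ℝ) (ξ : B) : Set A := {χ | ∀ χ', P₁ χ' ξ ≤ P₁ χ ξ}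

/-- The best replies of player II to the strategy `χ` of player I; `P₂` is the payoff of II. -/
def bestRepliesII (P₂ : A → B → ℝ) (χ : A) : Set B := {ξ | ∀ ξ', P₂ χ ξ' ≤ P₂ χ ξ}

/-- A strategy profile is a Nash equilibrium if each strategy is a best reply to the other. -/
def IsNashEquilibrium (P₁ P₂ : A → B → ℝ) (χ : A) (ξ : B) : Prop :=
  χ ∈ bestRepliesI P₁ ξ ∧ ξ ∈ bestRepliesII P₂ χ

/-- Nash equilibrium of the zero-sum game in which player I is paid `P` and player II `-P`. -/
def IsZeroSumNashEquilibrium (P : A → B → ℝ) (χ : A) (ξ : B) : Prop :=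
  IsNashEquilibrium P (fun a b => -P a b) χ ξ

/-- `v` is the value of the zero-sum game with payoff `P` to player I. -/
def HasValue (P : A → B → ℝ) (v : ℝ) : Prop :=
  (⨆ χ, ⨅ ξ, P χ ξ) = v ∧ (⨅ ξ, ⨆ χ, P χ ξ) = v

/-- The expected payoff when both players use (independent) mixed strategies, i.e. probability
measures on their sets of pure strategies. -/
def expectedPayoff [MeasurableSpace A] [MeasurableSpace B] (P : A → B → ℝ)
    (χ : ProbabilityMeasure A) (ξ : ProbabilityMeasure B) : ℝ :=
  ∫ p, P p.1 p.2 ∂((χ : Measure A).prod (ξ : Measure B))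

end Games

/-! ### Matrices, unitary groups and Haar measure -/

instance instMeasurableSpaceMatrix (m n : Type*) : MeasurableSpace (Matrix m n ℂ) :=
  inferInstanceAs (MeasurableSpace (m → n → ℂ))

instance instBorelSpaceMatrix (m n : Type*) [Fintype m] [Fintype n] :
    BorelSpace (Matrix m n ℂ) :=
  inferInstanceAs (BorelSpace (m → n → ℂ))

instance instCompactSpaceUnitaryGroup (d : ℕ) :
    CompactSpace (Matrix.unitaryGroup (Fin d) ℂ) := by
  have hK : IsCompact (Set.pi Set.univ fun _ : Fin d =>
      Set.pi Set.univ fun _ : Fin d => Metric.closedBall (0 : ℂ) 1) :=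
    isCompact_univ_pi fun _ => isCompact_univ_pi fun _ => isCompact_closedBall 0 1
  have hc : IsClosed ((Matrix.unitaryGroup (Fin d) ℂ : Submonoid _) :
      Set (Matrix (Fin d) (Fin d) ℂ)) := by
    have : ((Matrix.unitaryGroup (Fin d) ℂ : Submonoid _) : Set (Matrix (Fin d) (Fin d) ℂ))
        = {U | U * star U = 1} := by
      ext U
      exact Matrix.mem_unitaryGroup_iff
    rw [this]
    exact isClosed_eq (by fun_prop) continuous_const
  refine isCompact_iff_compactSpace.mp (hK.of_isClosed_subset hc ?_)
  intro U hU i _ j _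
  simpa using entry_norm_bound_of_unitary hU i j

/-- The Haar probability measure on the unitary group `U(d)`. -/
def haarUnitary (d : ℕ) : ProbabilityMeasure (Matrix.unitaryGroup (Fin d) ℂ) :=
  ⟨Measure.haarMeasure ⊤, ⟨by
    simpa using Measure.haarMeasure_self
      (K₀ := (⊤ : TopologicalSpace.PositiveCompacts (Matrix.unitaryGroup (Fin d) ℂ)))⟩⟩

/-- Pure states of `ℂ^d`, represented by unit vectors. -/
abbrev PureState (d : ℕ) : Type := Metric.sphere (0 : EuclideanSpace ℂ (Fin d)) 1

/-- The action of a unitary matrix on pure states. -/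
def act {d : ℕ} (U : Matrix.unitaryGroup (Fin d) ℂ) (ψ : PureState d) : PureState d :=
  ⟨WithLp.toLp 2 ((U : Matrix (Fin d) (Fin d) ℂ) *ᵥ (ψ : EuclideanSpace ℂ (Fin d)).ofLp), by
    have key : ∀ v : EuclideanSpace ℂ (Fin d), ((‖v‖ ^ 2 : ℝ) : ℂ) = star v.ofLp ⬝ᵥ v.ofLp := by
      intro v
      rw [EuclideanSpace.norm_sq_eq]
      simp [dotProduct, Complex.conj_mul']
    have hU : (U : Matrix (Fin d) (Fin d) ℂ)ᴴ * (U : Matrix (Fin d) (Fin d) ℂ) = 1 :=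
      Matrix.mem_unitaryGroup_iff'.mp U.2
    have hψ : ‖(ψ : EuclideanSpace ℂ (Fin d))‖ = 1 := by simp
    rw [mem_sphere_zero_iff_norm, ← sq_eq_sq₀ (norm_nonneg _) zero_le_one]
    have h1 := key (ψ : EuclideanSpace ℂ (Fin d))
    have h2 := key (WithLp.toLp 2
      ((U : Matrix (Fin d) (Fin d) ℂ) *ᵥ (ψ : EuclideanSpace ℂ (Fin d)).ofLp))
    rw [Matrix.star_mulVec, Matrix.dotProduct_mulVec, Matrix.vecMul_vecMul, hU, Matrix.vecMul_one,
      ← h1, hψ] at h2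
    exact_mod_cast h2⟩

theorem continuous_act {d : ℕ} (ψ : PureState d) :
    Continuous fun U : Matrix.unitaryGroup (Fin d) ℂ => act U ψ := by
  unfold act
  refine Continuous.subtype_mk ?_ _
  refine (PiLp.continuous_toLp 2 _).comp ?_
  exact Continuous.matrix_mulVec continuous_subtype_val continuous_const

/-- Player II's mixed strategy of choosing the pure state `U ψ₀`, `U` being distributed according
to the Haar measure of the unitary group. -/
def uniformPureState {d : ℕ} (ψ₀ : PureState d) : ProbabilityMeasure (PureState d) :=
  (haarUnitary d).map (f := fun U => act U ψ₀) (continuous_act ψ₀).measurable.aemeasurable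

/-! ### Tensor powers

The space `(ℂ^d)^{⊗N}` is the space of functions on the index set `Fin N → Fin d`. -/

/-- Operators on `(ℂ^d)^{⊗N}`. -/
abbrev TensorOp (d N : ℕ) : Type := Matrix (Fin N → Fin d) (Fin N → Fin d) ℂ

/-- The vector `v^{⊗N}`. -/
def tensorVec {d : ℕ} (N : ℕ) (v : Fin d → ℂ) : (Fin N → Fin d) → ℂ :=
  fun i => ∏ k, v (i k)

/-- The operator `A^{⊗N}`. -/
def tensorMat {d : ℕ} (N : ℕ) (A : Matrix (Fin d) (Fin d) ℂ) : TensorOp d N :=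
  Matrix.of fun i j => ∏ k, A (i k) (j k)

/-- The rank-one operator `|v⟩⟨v|`. -/
def ketbra {n : Type*} (v : n → ℂ) : Matrix n n ℂ := Matrix.vecMulVec v (star v)

/-- The state `|ψ⟩⟨ψ|`. -/
def PureState.density {d : ℕ} (ψ : PureState d) : Matrix (Fin d) (Fin d) ℂ :=
  ketbra (ψ : EuclideanSpace ℂ (Fin d)).ofLp

/-- The state `(|ψ⟩⟨ψ|)^{⊗N}`. -/
def PureState.copies {d : ℕ} (N : ℕ) (ψ : PureState d) : TensorOp d N :=
  tensorMat N ψ.density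

/-! ### The SWAP test -/

/-- The operator exchanging the two factors of a tensor square. -/
def swapOp (n : Type*) [DecidableEq n] : Matrix (n × n) (n × n) ℂ :=
  Matrix.of fun p q => if p.1 = q.2 ∧ p.2 = q.1 then 1 else 0

/-- Probability that `ρ ⊗ σ` passes the SWAP test: the measurement of the projection
`(1 + SWAP)/2`. -/
def swapTestPassProb {n : Type*} [Fintype n] [DecidableEq n] (ρ σ : Matrix n n ℂ) : ℝ :=
  (Matrix.trace (((1 / 2 : ℂ) • (1 + swapOp n)) * (ρ ⊗ₖ σ))).re

/-- Expected payoff of player I: `1` if the SWAP test is passed and `-1` if it is failed. -/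
def swapTestPayoff {n : Type*} [Fintype n] [DecidableEq n] (ρ σ : Matrix n n ℂ) : ℝ :=
  swapTestPassProb ρ σ * 1 + (1 - swapTestPassProb ρ σ) * (-1)

/-! ### The state estimation game -/

/-- A measurement with `R` outcomes on `N` copies (a POVM `E₁, …, E_R` on `(ℂ^d)^{⊗N}`), together
with the pure state submitted after each outcome. -/
abbrev Measurement (d N R : ℕ) : Type :=
  {p : (Fin R → TensorOp d N) × (Fin R → PureState d) //
    (∀ r, (p.1 r).PosSemidef) ∧ ∑ r, p.1 r = 1}

/-- The POVM element of outcome `r`. -/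
def Measurement.effect {d N R : ℕ} (S : Measurement d N R) (r : Fin R) : TensorOp d N := S.1.1 r

/-- The pure state submitted after outcome `r`. -/
def Measurement.guess {d N R : ℕ} (S : Measurement d N R) (r : Fin R) : PureState d := S.1.2 r

/-- Pure strategies of player I in the estimation game: a measurement with any finite number of
outcomes. -/
abbrev EstimationStrategy (d N : ℕ) : Type := Σ R : ℕ, Measurement d N R

/-- The state `∑ᵣ tr(Eᵣ ρ) |φᵣ⟩⟨φᵣ|` that the referee receives from player I. -/
def EstimationStrategy.output {d N : ℕ} (S : EstimationStrategy d N) (ρ : TensorOp d N) :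
    Matrix (Fin d) (Fin d) ℂ :=
  ∑ r, Matrix.trace (S.2.effect r * ρ) • (S.2.guess r).density

/-- Payoff of player I in the estimation game, for pure strategies. -/
def estimationPayoff (d N : ℕ) (S : EstimationStrategy d N) (ψ : PureState d) : ℝ :=
  swapTestPayoff (S.output (ψ.copies N)) ψ.density

theorem tensorMat_mul {d : ℕ} (N : ℕ) (A B : Matrix (Fin d) (Fin d) ℂ) :
    tensorMat N (A * B) = tensorMat N A * tensorMat N B := by
  ext i j
  simp only [tensorMat, Matrix.of_apply, Matrix.mul_apply]
  rw [Finset.prod_univ_sum]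
  simp [Finset.prod_mul_distrib]

theorem tensorMat_one {d : ℕ} (N : ℕ) :
    tensorMat N (1 : Matrix (Fin d) (Fin d) ℂ) = 1 := by
  ext i j
  simp only [tensorMat, Matrix.of_apply, Matrix.one_apply]
  rw [Finset.prod_ite_zero]
  simp [funext_iff]

theorem tensorMat_conjTranspose {d : ℕ} (N : ℕ) (A : Matrix (Fin d) (Fin d) ℂ) :
    (tensorMat N A)ᴴ = tensorMat N Aᴴ := by
  ext i j
  simp [tensorMat, Matrix.conjTranspose_apply]

/-- The measurement `S` carried out with respect to the axes rotated by `U`: the POVM elements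
become `U^{⊗N} Eᵣ (U^{⊗N})†`, and the submitted states become `U φᵣ`. -/
def Measurement.rotate {d N R : ℕ} (S : Measurement d N R) (U : Matrix.unitaryGroup (Fin d) ℂ) :
    Measurement d N R :=
  ⟨(fun r => tensorMat N (U : Matrix (Fin d) (Fin d) ℂ) * S.effect r *
      (tensorMat N (U : Matrix (Fin d) (Fin d) ℂ))ᴴ, fun r => act U (S.guess r)), by
    refine ⟨fun r => (S.2.1 r).mul_mul_conjTranspose_same _, ?_⟩
    have h : ∑ r, S.effect r = 1 := S.2.2
    have hU : (U : Matrix (Fin d) (Fin d) ℂ) * (U : Matrix (Fin d) (Fin d) ℂ)ᴴ = 1 :=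
      Matrix.mem_unitaryGroup_iff.mp U.2
    simp only
    rw [← Finset.sum_mul, ← Finset.mul_sum, h, mul_one, tensorMat_conjTranspose, ← tensorMat_mul,
      hU, tensorMat_one]⟩

theorem measurable_rotate {d N R : ℕ} (S : Measurement d N R) :
    Measurable fun U : Matrix.unitaryGroup (Fin d) ℂ =>
      (⟨R, S.rotate U⟩ : EstimationStrategy d N) := by
  have hmk : Measurable (fun T : Measurement d N R => (⟨R, T⟩ : EstimationStrategy d N)) := by
    intro s hs
    exact (MeasurableSpace.measurableSet_iInf.mp hs) R
  refine hmk.comp (Measurable.subtype_mk ?_)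
  have ht : Continuous fun U : Matrix.unitaryGroup (Fin d) ℂ =>
      tensorMat N (U : Matrix (Fin d) (Fin d) ℂ) := by
    refine continuous_matrix fun i j => ?_
    simp only [tensorMat, Matrix.of_apply]
    exact continuous_finsetProd _ fun k _ =>
      (continuous_subtype_val.matrix_elem (i k) (j k))
  refine Measurable.prodMk (measurable_pi_lambda _ fun r => ?_) (measurable_pi_lambda _ fun r => ?_)
  · exact ((ht.mul continuous_const).mul ht.matrix_conjTranspose).measurable
  · exact (continuous_act _).measurable

/-- Player I's mixed strategy of carrying out the measurement `S` with axes chosen with uniform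
probability according to the unitary group. -/
def randomAxes {d N R : ℕ} (S : Measurement d N R) :
    ProbabilityMeasure (EstimationStrategy d N) :=
  (haarUnitary d).map (f := fun U => ⟨R, S.rotate U⟩) (measurable_rotate S).aemeasurable

/-! ### Spin-`N/2` states of `N` qubits

The index `k : Fin (N + 1)` stands for the magnetic quantum number `m = N/2 - k`; the basis vector
`0` of a qubit is spin up and the basis vector `1` is spin down. -/

/-- The magnetic quantum number `m = N/2 - k`. -/
def spinM (N : ℕ) (k : Fin (N + 1)) : ℝ := (N : ℝ) / 2 - (k : ℕ)

/-- The state `|N/2, m⟩` of `N` qubits: the normalized sum of the basis vectors with exactly `k`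
spins down. -/
def spinState (N : ℕ) (k : Fin (N + 1)) : (Fin N → Fin 2) → ℂ :=
  fun i => if (Finset.univ.filter fun l => i l = 1).card = (k : ℕ) then
    ((1 / Real.sqrt (N.choose k) : ℝ) : ℂ) else 0

/-- The matrix element `d^{N/2}_{m,N/2}(θ)` of the rotation operator of a spin-`N/2` particle,
`√(N choose k) cos(θ/2)^{N-k} sin(θ/2)^k`. -/
def wignerD (N : ℕ) (k : Fin (N + 1)) (θ : ℝ) : ℝ :=
  Real.sqrt (N.choose k) * Real.cos (θ / 2) ^ (N - (k : ℕ)) * Real.sin (θ / 2) ^ (k : ℕ)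

/-- The coefficient
`c e^{-iη(m-n)} d^{N/2}_{m,N/2}(θ) d^{N/2}_{n,N/2}(θ)`. -/
def effectCoeff (N : ℕ) (c η θ : ℝ) (k l : Fin (N + 1)) : ℂ :=
  (c : ℂ) * Complex.exp (-Complex.I * η * ((spinM N k - spinM N l : ℝ) : ℂ)) *
    (wignerD N k θ : ℂ) * (wignerD N l θ : ℂ)

/-- `S` is a measurement with outcomes `r = 1, …, R` of the form
`E_r = ∑_{m,n} c_r e^{-iη_r(m-n)} d^{N/2}_{m,N/2}(θ_r) d^{N/2}_{n,N/2}(θ_r) |m⟩⟨n|`,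
where `∑_r c_r e^{-iη_r(m-n)} d^{N/2}_{m,N/2}(θ_r) d^{N/2}_{n,N/2}(θ_r) = δ_{m,n}`, and submits
after outcome `r` a qubit `φ_r` with
`φ_r^{⊗N} = ∑_m e^{-iη_r m} d^{N/2}_{m,N/2}(θ_r) |m⟩`.
The `E_r` sum up to the projection onto the span of the `|m⟩`, which contains the state of every
`N` identical qubits. One further outcome, of probability zero on such states and with an arbitrary
submitted state, completes them to a POVM on the whole of `(ℂ²)^{⊗N}`. -/
def IsCoherentMeasurement {N R : ℕ} (S : Measurement 2 N (R + 1)) : Prop :=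
  ∃ c η θ : Fin R → ℝ,
    (∀ r, 0 ≤ c r) ∧
    (∀ k l, ∑ r, effectCoeff N (c r) (η r) (θ r) k l = if k = l then 1 else 0) ∧
    (∀ r, S.effect r.castSucc =
      ∑ k, ∑ l, effectCoeff N (c r) (η r) (θ r) k l •
        Matrix.vecMulVec (spinState N k) (star (spinState N l))) ∧
    (∀ r, tensorVec N (S.guess r.castSucc : EuclideanSpace ℂ (Fin 2)).ofLp =
      ∑ k, (Complex.exp (-Complex.I * η r * (spinM N k : ℂ)) * (wignerD N k (θ r) : ℂ)) •
        spinState N k)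

/-! ### The cloning game -/

/-- Quantum channels from `B(ℂ^m)` to `B(ℂ^n)`: completely positive trace-preserving linear maps.
Complete positivity: for every `k` the map `id_k ⊗ T` preserves positivity. -/
structure Channel (m n : Type*) [Fintype m] [Fintype n] where
  /-- The underlying linear map. -/
  map : Matrix m m ℂ →ₗ[ℂ] Matrix n n ℂ
  completelyPositive : ∀ (k : ℕ) (X : Matrix (Fin k × m) (Fin k × m) ℂ), X.PosSemidef →
    (Matrix.of fun (p q : Fin k × n) =>
      map (Matrix.of fun i j => X (p.1, i) (q.1, j)) p.2 q.2).PosSemidef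
  trace_map : ∀ X, (map X).trace = X.trace

/-- The σ-algebra on channels generated by the evaluation maps `T ↦ T(ρ)`. -/
instance Channel.instMeasurableSpace (m n : Type*) [Fintype m] [Fintype n] :
    MeasurableSpace (Channel m n) :=
  MeasurableSpace.comap (fun (T : Channel m n) (ρ : Matrix m m ℂ) => T.map ρ) inferInstance

/-- Pure strategies of player I in the cloning game: devices turning `N` systems into `M`. -/
abbrev CloningStrategy (d N M : ℕ) : Type := Channel (Fin N → Fin d) (Fin M → Fin d)

/-- Payoff of player I in the cloning game, for pure strategies. -/
def cloningPayoff (d N M : ℕ) (T : CloningStrategy d N M) (ψ : PureState d) : ℝ :=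
  swapTestPayoff (T.map (ψ.copies N)) (ψ.copies M)

/-- The operator on `(ℂ^d)^{⊗M}` that permutes the tensor factors by `π`. -/
def permOp (d M : ℕ) (π : Equiv.Perm (Fin M)) : TensorOp d M :=
  Matrix.of fun i j => if i ∘ π = j then 1 else 0

/-- The orthogonal projection `s_M` of `(ℂ^d)^{⊗M}` onto its Bose space (the vectors invariant
under permutations of the factors). -/
def boseProj (d M : ℕ) : TensorOp d M :=
  ((M.factorial : ℂ)⁻¹) • ∑ π : Equiv.Perm (Fin M), permOp d M π

/-- The operator `ρ ⊗ 1^{⊗(M-N)}` on `(ℂ^d)^{⊗M}`. -/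
def tensorIdentity {d N M : ℕ} (h : N ≤ M) (ρ : TensorOp d N) : TensorOp d M :=
  Matrix.of fun i j => if ∀ k : Fin M, N ≤ (k : ℕ) → i k = j k then
    ρ (fun k => i (Fin.castLE h k)) (fun k => j (Fin.castLE h k)) else 0

/-- The dimension `d[N] = (d+N-1 choose N)` of the Bose space of `(ℂ^d)^{⊗N}`. -/
def boseDim (d N : ℕ) : ℕ := (d + N - 1).choose N

/-- `T` is a cloning device that acts as `ρ ↦ (d[N]/d[M]) s_M (ρ ⊗ 1^{⊗(M-N)}) s_M` on all operators
`ρ` of the Bose space of `(ℂ^d)^{⊗N}` (the states of `N` identical copies are among them). -/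
def IsWernerCloner {d N M : ℕ} (h : N ≤ M) (T : CloningStrategy d N M) : Prop :=
  ∀ ρ : TensorOp d N, boseProj d N * ρ * boseProj d N = ρ →
    T.map ρ = ((boseDim d N : ℂ) / (boseDim d M : ℂ)) •
      (boseProj d M * tensorIdentity h ρ * boseProj d M)

/-- The mixed strategy that uses the pure strategy `a` with certainty. -/
def pureAsMixed {A : Type*} [MeasurableSpace A] (a : A) : ProbabilityMeasure A :=
  ⟨Measure.dirac a, inferInstance⟩

end QuantumGames

end

noncomputable section

namespace QuantumGames

/-! ### Projections and positive semidefinite matrices -/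

section Projections

variable {n : Type*} [Fintype n]

/-! Both games rest on one fact, `meanCopies_uniformPureState`: the mean of ψ^{⊗N} (written for
(|ψ⟩⟨ψ|)^{⊗N}) over a uniform ψ is s_N/d[N]. Haar invariance makes this mean commute with every
V^{⊗N}. Diagonal V make e_a^{⊗N} an eigenvector, transitivity of U(d) on unit vectors gives all
product vectors the same eigenvalue, and product vectors span the Bose space
(`eq_zero_of_sum_mul_tensorVec`). The scalar follows from the trace, since tr s_N = d[N] by
Burnside's lemma.

For normalized states the SWAP payoff is Re tr(ρσ). In the estimation game tr(E_r ψ^{⊗N}) tr(φ_r ψ)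
= tr((E_r ⊗ φ_r) ψ^{⊗(N+1)}), so the payoff against ξ* is tr(B s_{N+1})/d[N+1] with B = ∑ s_N E_r
s_N ⊗ φ_r positive of trace d[N]; hence it is at most d[N]/d[N+1]. In the cloning game ψ^{⊗N} ≤ s_N
bounds the payoff against ξ* by tr(T(s_N) s_M)/d[M] ≤ d[N]/d[M].

Conversely, a coherent measurement has E_r = c_r φ_r^{⊗N} with ∑ c_r = N+1, so outcome r contributes
c_r |⟨Uφ_r|ψ⟩|^{2(N+1)}, whose mean over U is c_r/(N+2) for every ψ. A Werner cloner earns exactly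
d[N]/d[M] on every ψ. `isZeroSumNashEquilibrium_of_pure_bounds` turns such matching bounds on pure
strategies into equilibrium and value.

Existence of the measurement comes from Carathéodory's theorem, which replaces the uniform mean of
ψ^{⊗N} by a finite one; existence of the cloner comes from explicit Kraus operators, whose trace
preservation is `trace_tensorMul_one_mul_boseProj`. -/

theorem posSemidef_of_projection {P : Matrix n n ℂ} (hP : P.IsHermitian) (hP2 : P * P = P) :
    P.PosSemidef := by
  have h := Matrix.posSemidef_conjTranspose_mul_self P
  rwa [hP.eq, hP2] at h

theorem posSemidef_one_sub_projection [DecidableEq n] {P : Matrix n n ℂ}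
    (hP : P.IsHermitian) (hP2 : P * P = P) :
    (1 - P).PosSemidef :=
  posSemidef_of_projection (Matrix.isHermitian_one.sub hP) (by
    simp [mul_sub, sub_mul, hP2])

theorem trace_mul_projection_nonneg {A P : Matrix n n ℂ} (hA : A.PosSemidef)
    (hP : P.IsHermitian) (hP2 : P * P = P) : 0 ≤ (A * P).trace := by
  have h := (hA.mul_mul_conjTranspose_same P).trace_nonneg
  rwa [hP.eq, mul_assoc, Matrix.trace_mul_comm, mul_assoc, hP2] at h

theorem trace_mul_projection_le [DecidableEq n] {A P : Matrix n n ℂ} (hA : A.PosSemidef)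
    (hP : P.IsHermitian) (hP2 : P * P = P) : (A * P).trace ≤ A.trace := by
  have h := trace_mul_projection_nonneg hA (Matrix.isHermitian_one.sub hP)
    (by simp [mul_sub, sub_mul, hP2] : (1 - P) * (1 - P) = 1 - P)
  rw [mul_sub, mul_one, Matrix.trace_sub] at h
  exact sub_nonneg.mp h

end Projections

/-! ### Copies of a pure state -/

section Copies

variable {d : ℕ}

theorem tensorMat_ketbra (N : ℕ) (v : Fin d → ℂ) :
    tensorMat N (ketbra v) = ketbra (tensorVec N v) := by
  ext i j
  simp [tensorMat, ketbra, tensorVec, Matrix.vecMulVec_apply, Finset.prod_mul_distrib]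

theorem PureState.copies_eq_ketbra (N : ℕ) (ψ : PureState d) :
    ψ.copies N = ketbra (tensorVec N (ψ : EuclideanSpace ℂ (Fin d)).ofLp) :=
  tensorMat_ketbra N _

theorem ketbra_isHermitian {n : Type*} (v : n → ℂ) : (ketbra v).IsHermitian := by
  ext i j
  simp [ketbra, Matrix.vecMulVec_apply, mul_comm]

theorem trace_tensorMat (N : ℕ) (A : Matrix (Fin d) (Fin d) ℂ) :
    (tensorMat N A).trace = A.trace ^ N := by
  simp only [Matrix.trace, Matrix.diag_apply, tensorMat, Matrix.of_apply]
  rw [Fintype.sum_pow]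

theorem PureState.dotProduct_star_self (ψ : PureState d) :
    (ψ : EuclideanSpace ℂ (Fin d)).ofLp ⬝ᵥ star (ψ : EuclideanSpace ℂ (Fin d)).ofLp = 1 := by
  have h : ‖(ψ : EuclideanSpace ℂ (Fin d))‖ = 1 := by simp
  have h2 : ((‖(ψ : EuclideanSpace ℂ (Fin d))‖ ^ 2 : ℝ) : ℂ) = 1 := by simp [h]
  rw [EuclideanSpace.norm_sq_eq] at h2
  rw [← h2]
  simp [dotProduct, Complex.mul_conj']

theorem PureState.trace_density (ψ : PureState d) : ψ.density.trace = 1 := by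
  rw [PureState.density, ketbra, Matrix.trace_vecMulVec, ψ.dotProduct_star_self]

theorem PureState.density_mul_self (ψ : PureState d) : ψ.density * ψ.density = ψ.density := by
  rw [PureState.density, ketbra, Matrix.vecMulVec_mul_vecMulVec, dotProduct_comm,
    ψ.dotProduct_star_self]
  simp

theorem PureState.trace_copies (N : ℕ) (ψ : PureState d) : (ψ.copies N).trace = 1 := by
  rw [PureState.copies, trace_tensorMat, ψ.trace_density, one_pow]

theorem PureState.copies_mul_self (N : ℕ) (ψ : PureState d) :
    ψ.copies N * ψ.copies N = ψ.copies N := by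
  rw [PureState.copies, ← tensorMat_mul, ψ.density_mul_self]

theorem PureState.isHermitian_copies (N : ℕ) (ψ : PureState d) : (ψ.copies N).IsHermitian := by
  rw [ψ.copies_eq_ketbra]
  exact ketbra_isHermitian _

theorem PureState.posSemidef_copies (N : ℕ) (ψ : PureState d) : (ψ.copies N).PosSemidef :=
  posSemidef_of_projection (ψ.isHermitian_copies N) (ψ.copies_mul_self N)

theorem trace_copies_mul_copies (N : ℕ) (φ ψ : PureState d) :
    (φ.copies N * ψ.copies N).trace = (φ.density * ψ.density).trace ^ N := by
  rw [PureState.copies, PureState.copies, ← tensorMat_mul, trace_tensorMat]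

theorem density_act (U : Matrix.unitaryGroup (Fin d) ℂ) (ψ : PureState d) :
    (act U ψ).density = (U : Matrix (Fin d) (Fin d) ℂ) * ψ.density *
      (U : Matrix (Fin d) (Fin d) ℂ)ᴴ := by
  simp only [PureState.density, act, ketbra]
  rw [Matrix.mul_vecMulVec, Matrix.vecMulVec_mul, Matrix.star_mulVec]

theorem copies_act (N : ℕ) (U : Matrix.unitaryGroup (Fin d) ℂ) (ψ : PureState d) :
    (act U ψ).copies N = tensorMat N (U : Matrix (Fin d) (Fin d) ℂ) * ψ.copies N *
      (tensorMat N (U : Matrix (Fin d) (Fin d) ℂ))ᴴ := by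
  rw [PureState.copies, density_act, tensorMat_mul, tensorMat_mul, tensorMat_conjTranspose]
  rfl

theorem act_act (U V : Matrix.unitaryGroup (Fin d) ℂ) (ψ : PureState d) :
    act U (act V ψ) = act (U * V) ψ := by
  apply Subtype.ext
  simp [act, Matrix.mulVec_mulVec]

end Copies

/-! ### Products of operators -/

section Product

variable {d N K : ℕ}

/-- The operator `A ⊗ B` on `(ℂ^d)^{⊗(N+K)}`. -/
def tensorMul (A : TensorOp d N) (B : TensorOp d K) : TensorOp d (N + K) :=
  (A ⊗ₖ B).submatrix (Fin.appendEquiv N K).symm (Fin.appendEquiv N K).symm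

theorem tensorMul_mul_tensorMul (A A' : TensorOp d N) (B B' : TensorOp d K) :
    tensorMul A B * tensorMul A' B' = tensorMul (A * A') (B * B') := by
  rw [tensorMul, tensorMul, tensorMul, Matrix.submatrix_mul_equiv, Matrix.mul_kronecker_mul]

theorem trace_tensorMul (A : TensorOp d N) (B : TensorOp d K) :
    (tensorMul A B).trace = A.trace * B.trace := by
  rw [← Matrix.trace_kronecker, tensorMul]
  exact Equiv.sum_comp (Fin.appendEquiv N K).symm fun i => (A ⊗ₖ B) i i

theorem posSemidef_tensorMul {A : TensorOp d N} {B : TensorOp d K} (hA : A.PosSemidef)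
    (hB : B.PosSemidef) : (tensorMul A B).PosSemidef :=
  (hA.kronecker hB).submatrix _

theorem PureState.copies_add (ψ : PureState d) :
    ψ.copies (N + K) = tensorMul (ψ.copies N) (ψ.copies K) := by
  ext i j
  simp [PureState.copies, tensorMul, tensorMat, Fin.prod_univ_add, Fin.appendEquiv]

/-- Once M is written as N + K, the cloner formula becomes accessible to the product rules for
`tensorMul`. -/
theorem tensorIdentity_eq_tensorMul (h : N ≤ N + K) (ρ : TensorOp d N) :
    tensorIdentity h ρ = tensorMul ρ 1 := by
  ext i j
  have : (∀ k : Fin (N + K), N ≤ (k : ℕ) → i k = j k) ↔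
      (fun k : Fin K => i (Fin.natAdd N k)) = fun k => j (Fin.natAdd N k) := by
    constructor
    · intro H
      funext k
      exact H _ (by simp)
    · intro H k hk
      have := congrFun H ⟨k - N, by omega⟩
      have hk' : Fin.natAdd N (⟨k - N, by omega⟩ : Fin K) = k := by
        ext; simp; omega
      simpa [hk'] using this
  simp only [tensorIdentity, Matrix.of_apply, this, tensorMul, Fin.appendEquiv,
    Matrix.submatrix_apply, Matrix.kroneckerMap_apply, Matrix.one_apply, Equiv.coe_fn_symm_mk,
    mul_ite, mul_one, mul_zero]
  rfl

end Product

/-! ### The Bose projection -/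

section Bose

variable {d : ℕ} (N : ℕ)

theorem permOp_mul_permOp (π σ : Equiv.Perm (Fin N)) :
    permOp d N π * permOp d N σ = permOp d N (π * σ) := by
  ext i j
  simp only [permOp, Matrix.mul_apply, Matrix.of_apply, mul_ite, mul_one, mul_zero]
  rw [Finset.sum_eq_single (i ∘ π) (fun b _ hb => by simp [hb.symm]) (by simp)]
  simp only [Function.comp_assoc, Equiv.Perm.coe_mul, if_true]
  congr

theorem conjTranspose_permOp (π : Equiv.Perm (Fin N)) :
    (permOp d N π)ᴴ = permOp d N π⁻¹ := by
  ext i j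
  have : j ∘ π = i ↔ i ∘ (π⁻¹ : Equiv.Perm (Fin N)) = j := by
    constructor <;> rintro rfl <;> ext <;> simp
  simp [permOp, Matrix.conjTranspose_apply, this, apply_ite]

theorem permOp_mulVec (π : Equiv.Perm (Fin N)) (v : (Fin N → Fin d) → ℂ) (i : Fin N → Fin d) :
    (permOp d N π *ᵥ v) i = v (i ∘ π) := by
  simp [permOp, Matrix.mulVec, dotProduct]

theorem permOp_mul_boseProj (π : Equiv.Perm (Fin N)) :
    permOp d N π * boseProj d N = boseProj d N := by
  rw [boseProj, Matrix.mul_smul, Finset.mul_sum]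
  simp only [permOp_mul_permOp]
  congr 1
  exact Equiv.sum_comp (Equiv.mulLeft π) fun σ => permOp d N σ

/-- The group average absorbs each single permutation, hence also their average. -/
theorem boseProj_mul_self : boseProj d N * boseProj d N = boseProj d N := by
  have h : boseProj d N * boseProj d N =
      ((N.factorial : ℂ)⁻¹) • ∑ π : Equiv.Perm (Fin N), permOp d N π * boseProj d N := by
    rw [← Finset.sum_mul, ← Matrix.smul_mul, ← boseProj]
  simp only [permOp_mul_boseProj] at h
  rw [h, Finset.sum_const, Finset.card_univ, Fintype.card_perm, Fintype.card_fin,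
    ← Nat.cast_smul_eq_nsmul ℂ, smul_smul, inv_mul_cancel₀ (by exact_mod_cast N.factorial_ne_zero),
    one_smul]

theorem isHermitian_boseProj : (boseProj d N).IsHermitian := by
  rw [Matrix.IsHermitian, boseProj, Matrix.conjTranspose_smul, Matrix.conjTranspose_sum]
  simp only [conjTranspose_permOp]
  congr 1
  · simp
  · exact Equiv.sum_comp (Equiv.inv (Equiv.Perm (Fin N))) fun σ => permOp d N σ

theorem posSemidef_boseProj : (boseProj d N).PosSemidef :=
  posSemidef_of_projection (isHermitian_boseProj N) (boseProj_mul_self N)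

theorem boseProj_mulVec_eq_self {v : (Fin N → Fin d) → ℂ}
    (hv : ∀ (π : Equiv.Perm (Fin N)) (i : Fin N → Fin d), v (i ∘ π) = v i) :
    boseProj d N *ᵥ v = v := by
  rw [boseProj, Matrix.smul_mulVec, Matrix.sum_mulVec]
  have : ∀ π : Equiv.Perm (Fin N), permOp d N π *ᵥ v = v := fun π => by
    ext i; rw [permOp_mulVec, hv]
  simp only [this]
  rw [Finset.sum_const, Finset.card_univ, Fintype.card_perm, Fintype.card_fin,
    ← Nat.cast_smul_eq_nsmul ℂ, smul_smul, inv_mul_cancel₀ (by exact_mod_cast N.factorial_ne_zero),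
    one_smul]

theorem tensorVec_comp_perm (w : Fin d → ℂ) (π : Equiv.Perm (Fin N)) (i : Fin N → Fin d) :
    tensorVec N w (i ∘ π) = tensorVec N w i :=
  Equiv.prod_comp π fun k => w (i k)

theorem boseProj_mulVec_tensorVec (w : Fin d → ℂ) :
    boseProj d N *ᵥ tensorVec N w = tensorVec N w :=
  boseProj_mulVec_eq_self N (tensorVec_comp_perm N w)

theorem boseProj_mul_copies (ψ : PureState d) : boseProj d N * ψ.copies N = ψ.copies N := by
  rw [ψ.copies_eq_ketbra, ketbra, Matrix.mul_vecMulVec, boseProj_mulVec_tensorVec]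

theorem copies_mul_boseProj (ψ : PureState d) : ψ.copies N * boseProj d N = ψ.copies N := by
  have h := congrArg Matrix.conjTranspose (boseProj_mul_copies N ψ)
  rwa [Matrix.conjTranspose_mul, (isHermitian_boseProj N).eq, (ψ.isHermitian_copies N).eq] at h

/-- The copies form a subprojection of s_N, so the difference is again a projection. This operator
inequality ψ^{⊗N} ≤ s_N is what bounds the cloning payoff. -/
theorem posSemidef_boseProj_sub_copies (ψ : PureState d) :
    (boseProj d N - ψ.copies N).PosSemidef :=
  posSemidef_of_projection ((isHermitian_boseProj N).sub (ψ.isHermitian_copies N)) (by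
    simp [mul_sub, sub_mul, boseProj_mul_self, boseProj_mul_copies, copies_mul_boseProj,
      ψ.copies_mul_self])

/-- Words with the same multiset of letters have fibres of equal size over each letter; bijections
between the fibres glue to a permutation. -/
theorem exists_comp_perm_eq {α : Type*} {N : ℕ} {i j : Fin N → α}
    (h : Finset.univ.val.map i = Finset.univ.val.map j) :
    ∃ π : Equiv.Perm (Fin N), i ∘ π = j := by
  classical
  have hc : ∀ a, Fintype.card {k // j k = a} = Fintype.card {k // i k = a} := fun a => by
    have := congrArg (Multiset.count a) h
    simp only [Multiset.count_map] at this
    rw [Fintype.card_subtype, Fintype.card_subtype, Finset.card_def, Finset.card_def]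
    simp only [Finset.filter_val, eq_comm (b := a)]
    exact this.symm
  refine ⟨(Equiv.sigmaFiberEquiv j).symm.trans
    ((Equiv.sigmaCongrRight fun a => Fintype.equivOfCardEq (hc a)).trans
      (Equiv.sigmaFiberEquiv i)), ?_⟩
  funext k
  exact (Fintype.equivOfCardEq (hc (j k)) ⟨k, rfl⟩).2

/-- The dimension of the Bose space, by Burnside's lemma. -/
theorem trace_boseProj (d N : ℕ) : (boseProj d N).trace = boseDim d N := by
  classical
  -- The domain action turns precomposition with a permutation into a left action on words.
  let G := (Equiv.Perm (Fin N))ᵈᵐᵃ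
  let X := Fin N → Fin d
  let eG : Equiv.Perm (Fin N) ≃ G := DomMulAct.mk
  have : Fintype G := Fintype.ofEquiv _ eG
  -- The multiset of letters is a complete orbit invariant, so orbits are counted by stars and bars.
  let f : X → Sym (Fin d) N := fun i => ⟨Finset.univ.val.map i, by simp⟩
  have hf : ∀ i j : X, f i = f j ↔ (MulAction.orbitRel G X) i j := by
    intro i j
    rw [MulAction.orbitRel_apply, MulAction.mem_orbit_iff]
    constructor
    · intro h
      obtain ⟨π, hπ⟩ := exists_comp_perm_eq (congrArg Subtype.val h).symm
      exact ⟨eG π, hπ⟩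
    · rintro ⟨g, rfl⟩
      obtain ⟨π, rfl⟩ := eG.surjective g
      apply Subtype.ext
      change Finset.univ.val.map (j ∘ π) = Finset.univ.val.map j
      rw [← Multiset.map_map, ← Equiv.coe_toEmbedding π, ← Finset.map_val, Finset.map_univ_equiv]
  have hsurj : Function.Surjective f := by
    rintro ⟨s, hs⟩
    obtain ⟨l, rfl⟩ := Quotient.exists_rep s
    subst hs
    refine ⟨l.get, Subtype.ext ?_⟩
    change Finset.univ.val.map l.get = (l : Multiset (Fin d))
    rw [Fin.univ_val_map, List.ofFn_get]
  let e : MulAction.orbitRel.Quotient G X ≃ Sym (Fin d) N :=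
    Equiv.ofBijective (Quotient.lift f fun i j h => (hf i j).mpr h)
      ⟨by
        rintro ⟨i⟩ ⟨j⟩ h
        exact Quotient.sound ((hf i j).mp h), fun s => by
        obtain ⟨i, hi⟩ := hsurj s
        exact ⟨Quotient.mk _ i, hi⟩⟩
  have hB := MulAction.sum_card_fixedBy_eq_card_orbits_mul_card_group G X
  rw [Fintype.card_congr e, Sym.card_sym_eq_choose, Fintype.card_fin, ← Fintype.card_congr eG,
    Fintype.card_perm, Fintype.card_fin, ← Equiv.sum_comp eG] at hB
  rw [boseProj, Matrix.trace_smul, Matrix.trace_sum]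
  -- The trace of a permutation matrix counts the fixed words, so tr s_N is the Burnside average.
  have ht : ∀ π : Equiv.Perm (Fin N),
      (permOp d N π).trace = (Fintype.card (MulAction.fixedBy X (eG π)) : ℂ) := by
    intro π
    rw [Fintype.card_subtype]
    simp only [permOp, Matrix.trace, Matrix.diag_apply, Matrix.of_apply]
    rw [Finset.sum_boole]
    congr 2
  simp only [ht]
  rw [← Nat.cast_sum, hB, boseDim, Nat.cast_mul, smul_eq_mul, mul_comm, mul_assoc,
    mul_inv_cancel₀ (by exact_mod_cast N.factorial_ne_zero), mul_one]

end Bose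

/-! ### The mean of `N` copies of a random pure state -/

section MeanCopies

variable {d : ℕ} (N : ℕ)

theorem continuous_copies (i j : Fin N → Fin d) :
    Continuous fun ψ : PureState d => ψ.copies N i j := by
  simp only [PureState.copies, tensorMat, PureState.density, ketbra, Matrix.of_apply,
    Matrix.vecMulVec_apply, Pi.star_apply]
  fun_prop

theorem continuous_copies_matrix : Continuous fun ψ : PureState d => ψ.copies N :=
  continuous_matrix (continuous_copies N)

theorem integrable_copies (μ : Measure (PureState d)) [IsFiniteMeasure μ] (i j : Fin N → Fin d) :
    Integrable (fun ψ => ψ.copies N i j) μ :=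
  (continuous_copies N i j).integrable_of_hasCompactSupport (HasCompactSupport.of_compactSpace _)

/-- The mean of `(|ψ⟩⟨ψ|)^{⊗N}` when `ψ` is distributed according to `μ`. -/
def meanCopies (μ : Measure (PureState d)) : TensorOp d N :=
  Matrix.of fun i j => ∫ ψ, ψ.copies N i j ∂μ

theorem integral_mul_copies_mul (μ : Measure (PureState d)) [IsFiniteMeasure μ]
    (A B : TensorOp d N) (i j : Fin N → Fin d) :
    ∫ ψ, (A * ψ.copies N * B) i j ∂μ = (A * meanCopies N μ * B) i j := by
  simp only [Matrix.mul_apply, meanCopies, Matrix.of_apply, Finset.sum_mul]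
  have h := integrable_copies N μ
  rw [integral_finsetSum _ fun k _ => integrable_finsetSum _ fun l _ =>
    ((h l k).const_mul _).mul_const _]
  refine Finset.sum_congr rfl fun k _ => ?_
  rw [integral_finsetSum _ fun l _ => ((h l k).const_mul _).mul_const _]
  refine Finset.sum_congr rfl fun l _ => ?_
  rw [integral_mul_const, integral_const_mul]

theorem integrable_trace_mul_copies (μ : Measure (PureState d)) [IsFiniteMeasure μ]
    (A : TensorOp d N) : Integrable (fun ψ => (A * ψ.copies N).trace) μ := by
  simp only [Matrix.trace, Matrix.diag_apply, Matrix.mul_apply]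
  exact integrable_finsetSum _ fun k _ => integrable_finsetSum _ fun l _ =>
    (integrable_copies N μ l k).const_mul _

theorem integral_trace_mul_copies (μ : Measure (PureState d)) [IsFiniteMeasure μ]
    (A : TensorOp d N) : ∫ ψ, (A * ψ.copies N).trace ∂μ = (A * meanCopies N μ).trace := by
  have h : ∀ i, Integrable (fun ψ : PureState d => (A * ψ.copies N) i i) μ := fun i => by
    simp only [Matrix.mul_apply]
    exact integrable_finsetSum _ fun l _ => (integrable_copies N μ l i).const_mul _
  have h2 : ∀ i, ∫ ψ : PureState d, (A * ψ.copies N) i i ∂μ = (A * meanCopies N μ) i i :=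
    fun i => by
      have h3 := integral_mul_copies_mul N μ A 1 i i
      rwa [mul_one, integral_congr_ae (g := fun ψ : PureState d => (A * ψ.copies N) i i)
        (Filter.Eventually.of_forall fun ψ => by rw [mul_one])] at h3
  calc ∫ ψ, (A * ψ.copies N).trace ∂μ
      = ∑ i, ∫ ψ : PureState d, (A * ψ.copies N) i i ∂μ := integral_finsetSum _ fun i _ => h i
    _ = (A * meanCopies N μ).trace := Finset.sum_congr rfl fun i _ => h2 i

theorem integral_re_trace_mul_copies (μ : Measure (PureState d)) [IsFiniteMeasure μ]
    (A : TensorOp d N) :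
    ∫ ψ, ((A * ψ.copies N).trace).re ∂μ = ((A * meanCopies N μ).trace).re := by
  rw [← integral_trace_mul_copies]
  exact integral_re (integrable_trace_mul_copies N μ A)

theorem trace_meanCopies (μ : Measure (PureState d)) [IsProbabilityMeasure μ] :
    (meanCopies N μ).trace = 1 := by
  have h := integral_trace_mul_copies N μ 1
  simp only [one_mul, PureState.trace_copies] at h
  rw [← h]
  simp

/-! ### Unitary invariance of the mean of the copies -/

theorem continuous_act_left (U : Matrix.unitaryGroup (Fin d) ℂ) :
    Continuous fun ψ : PureState d => act U ψ := by
  unfold act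
  refine Continuous.subtype_mk ?_ _
  refine (PiLp.continuous_toLp 2 _).comp ?_
  exact Continuous.matrix_mulVec continuous_const
    ((PiLp.continuous_ofLp 2 _).comp continuous_subtype_val)

theorem coe_haarUnitary (d : ℕ) :
    (haarUnitary d : Measure (Matrix.unitaryGroup (Fin d) ℂ)) = Measure.haarMeasure ⊤ := rfl

theorem coe_uniformPureState (ψ₀ : PureState d) :
    (uniformPureState ψ₀ : Measure (PureState d)) =
      (haarUnitary d : Measure (Matrix.unitaryGroup (Fin d) ℂ)).map fun U => act U ψ₀ := rfl

theorem map_act_uniformPureState (V : Matrix.unitaryGroup (Fin d) ℂ) (ψ₀ : PureState d) :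
    (uniformPureState ψ₀ : Measure (PureState d)).map (act V) = uniformPureState ψ₀ := by
  rw [coe_uniformPureState, Measure.map_map (continuous_act_left V).measurable
    (continuous_act ψ₀).measurable]
  have h : (act V ∘ fun U => act U ψ₀) = (fun U => act U ψ₀) ∘ fun U => V * U := by
    funext U
    exact act_act V U ψ₀
  rw [h, ← Measure.map_map (continuous_act ψ₀).measurable (measurable_const_mul V),
    coe_haarUnitary, map_mul_left_eq_self]

theorem tensorMat_mul_meanCopies (V : Matrix.unitaryGroup (Fin d) ℂ) (ψ₀ : PureState d) :
    tensorMat N (V : Matrix (Fin d) (Fin d) ℂ) * meanCopies N (uniformPureState ψ₀) *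
      (tensorMat N (V : Matrix (Fin d) (Fin d) ℂ))ᴴ = meanCopies N (uniformPureState ψ₀) := by
  ext i j
  rw [← integral_mul_copies_mul]
  simp only [← copies_act]
  rw [← integral_map (f := fun ψ => ψ.copies N i j) (continuous_act_left V).measurable.aemeasurable
    (continuous_copies N i j).aestronglyMeasurable, map_act_uniformPureState]
  rfl

theorem tensorMat_mulVec_tensorVec (A : Matrix (Fin d) (Fin d) ℂ) (w : Fin d → ℂ) :
    tensorMat N A *ᵥ tensorVec N w = tensorVec N (A *ᵥ w) := by
  ext i
  simp only [Matrix.mulVec, dotProduct, tensorMat, tensorVec, Matrix.of_apply]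
  rw [Finset.prod_univ_sum]
  simp [Finset.prod_mul_distrib]

/-- Invariance under conjugation by a unitary is the same as commuting with it; in this form
eigenvectors can be moved around by V. -/
theorem meanCopies_mulVec_tensorMat_mulVec (V : Matrix.unitaryGroup (Fin d) ℂ) (ψ₀ : PureState d)
    (v : (Fin N → Fin d) → ℂ) :
    meanCopies N (uniformPureState ψ₀ : Measure (PureState d)) *ᵥ
        (tensorMat N (V : Matrix (Fin d) (Fin d) ℂ) *ᵥ v) =
      tensorMat N (V : Matrix (Fin d) (Fin d) ℂ) *ᵥ
        (meanCopies N (uniformPureState ψ₀ : Measure (PureState d)) *ᵥ v) := by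
  have hV : (V : Matrix (Fin d) (Fin d) ℂ)ᴴ * (V : Matrix (Fin d) (Fin d) ℂ) = 1 :=
    Matrix.mem_unitaryGroup_iff'.mp V.2
  conv_lhs => rw [← tensorMat_mul_meanCopies N V]
  rw [Matrix.mulVec_mulVec, Matrix.mulVec_mulVec, mul_assoc _ _ (tensorMat N _),
    tensorMat_conjTranspose, ← tensorMat_mul, hV, tensorMat_one, mul_one]

theorem tensorMat_diagonal (w : Fin d → ℂ) :
    tensorMat N (Matrix.diagonal w) = Matrix.diagonal (tensorVec N w) := by
  ext i j
  simp only [tensorMat, tensorVec, Matrix.of_apply, Matrix.diagonal_apply]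
  rw [Finset.prod_ite_zero]
  simp [funext_iff]

/-- Invariance under diagonal unitaries. -/
theorem meanCopies_apply_const (ψ₀ : PureState d) (a : Fin d) (i : Fin N → Fin d)
    (hi : i ≠ fun _ => a) :
    meanCopies N (uniformPureState ψ₀ : Measure (PureState d)) i (fun _ => a) = 0 := by
  -- Order N + 1 suffices: the word i has between 1 and N letters different from a, so the phase it
  -- acquires is a power of ζ different from 1, while the constant word acquires none.
  obtain ⟨ζ, hζ⟩ : ∃ ζ : ℂ, IsPrimitiveRoot ζ (N + 1) :=
    ⟨_, Complex.isPrimitiveRoot_exp (N + 1) (by omega)⟩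
  have hζ1 : ‖ζ‖ = 1 := hζ.norm'_eq_one (by omega)
  let w : Fin d → ℂ := fun b => if b = a then 1 else ζ
  have hw : ∀ b, w b * star (w b) = 1 := fun b => by
    by_cases hb : b = a <;> simp [w, hb, Complex.mul_conj', hζ1]
  let V : Matrix.unitaryGroup (Fin d) ℂ := ⟨Matrix.diagonal w, by
    rw [Matrix.mem_unitaryGroup_iff, Matrix.star_eq_conjTranspose, Matrix.diagonal_conjTranspose,
      Matrix.diagonal_mul_diagonal, ← Matrix.diagonal_one]
    congr 1
    funext b
    exact hw b⟩
  have h := congrFun (congrFun (tensorMat_mul_meanCopies N V ψ₀) i) fun _ => a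
  simp only [V, tensorMat_diagonal, Matrix.diagonal_conjTranspose, Matrix.mul_diagonal,
    Matrix.diagonal_mul] at h
  have h1 : tensorVec N w (fun _ => a) = 1 := by simp [tensorVec, w]
  rw [Pi.star_apply, h1, star_one, mul_one] at h
  have h2 : tensorVec N w i ≠ 1 := by
    have : tensorVec N w i = ζ ^ (Finset.univ.filter fun k => ¬ i k = a).card := by
      simp [tensorVec, w, Finset.prod_ite]
    rw [this]
    refine hζ.pow_ne_one_of_pos_of_lt ?_ ?_
    · obtain ⟨k, hk⟩ := Function.ne_iff.mp hi
      exact (Finset.card_pos.mpr ⟨k, by simpa using hk⟩).ne'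
    · have := Finset.card_le_univ (Finset.univ.filter fun k => ¬ i k = a)
      rw [Fintype.card_fin] at this
      omega
  have h3 : (tensorVec N w i - 1) *
      meanCopies N (uniformPureState ψ₀ : Measure (PureState d)) i (fun _ => a) = 0 := by
    rw [sub_mul, h, one_mul, sub_self]
  exact (mul_eq_zero.mp h3).resolve_left (sub_ne_zero.mpr h2)

/-- Extend w to an orthonormal basis with w at index a and use the basis vectors as columns. -/
theorem exists_unitary_mulVec_single {w : Fin d → ℂ} (a : Fin d)
    (hw : ‖(WithLp.toLp 2 w : EuclideanSpace ℂ (Fin d))‖ = 1) :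
    ∃ U : Matrix.unitaryGroup (Fin d) ℂ,
      (U : Matrix (Fin d) (Fin d) ℂ) *ᵥ Pi.single a 1 = w := by
  obtain ⟨b, hb⟩ := Orthonormal.exists_orthonormalBasis_extension_of_card_eq (𝕜 := ℂ)
    (E := EuclideanSpace ℂ (Fin d)) (ι := Fin d) (by simp) (v := fun _ => WithLp.toLp 2 w)
    (s := {a}) ⟨fun _ => hw, fun i j hij => absurd (Subsingleton.elim i j) hij⟩
  refine ⟨⟨(EuclideanSpace.basisFun (Fin d) ℂ).toBasis.toMatrix b,
    OrthonormalBasis.toMatrix_orthonormalBasis_mem_unitary _ _⟩, ?_⟩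
  ext i
  simp [Module.Basis.toMatrix_apply, hb a rfl]

theorem tensorVec_smul (r : ℂ) (w : Fin d → ℂ) :
    tensorVec N (r • w) = r ^ N • tensorVec N w := by
  ext i
  simp [tensorVec, Finset.prod_mul_distrib]

/-- The vector e_a^{⊗N} is an eigenvector because its column has only a diagonal entry; every
nonzero w is a multiple of some U e_a, and the mean commutes with U^{⊗N}. The single constant c for
all w is the point. -/
theorem meanCopies_mulVec_tensorVec (ψ₀ : PureState d) :
    ∃ c : ℂ, ∀ w : Fin d → ℂ, w ≠ 0 →
      meanCopies N (uniformPureState ψ₀ : Measure (PureState d)) *ᵥ tensorVec N w =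
        c • tensorVec N w := by
  rcases isEmpty_or_nonempty (Fin d) with hd | ⟨⟨a⟩⟩
  · exact ⟨0, fun w hw => absurd (Subsingleton.elim w 0) hw⟩
  set X := meanCopies N (uniformPureState ψ₀ : Measure (PureState d)) with hX
  have he : tensorVec N (Pi.single a 1 : Fin d → ℂ) = Pi.single (fun _ => a) 1 := by
    ext i
    simp only [tensorVec, Pi.single_apply]
    rw [Finset.prod_ite_zero]
    simp [funext_iff]
  have h0 : X *ᵥ tensorVec N (Pi.single a 1) =
      X (fun _ => a) (fun _ => a) • tensorVec N (Pi.single a 1) := by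
    rw [he]
    ext i
    rw [Matrix.mulVec_single_one]
    by_cases hi : i = fun _ => a
    · subst hi; simp
    · simp [hi, meanCopies_apply_const N ψ₀ a i hi, hX]
  refine ⟨X (fun _ => a) (fun _ => a), fun w hw => ?_⟩
  have hw' : ‖(WithLp.toLp 2 w : EuclideanSpace ℂ (Fin d))‖ ≠ 0 := by
    simpa using hw
  set r : ℂ := (‖(WithLp.toLp 2 w : EuclideanSpace ℂ (Fin d))‖ : ℂ) with hr
  have hr0 : r ≠ 0 := by rw [hr]; exact_mod_cast hw'
  obtain ⟨U, hU⟩ := exists_unitary_mulVec_single (w := r⁻¹ • w) a (by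
    rw [WithLp.toLp_smul, norm_smul, norm_inv, hr, Complex.norm_real, norm_norm,
      inv_mul_cancel₀ hw'])
  have hwU : tensorVec N w = r ^ N •
      (tensorMat N (U : Matrix (Fin d) (Fin d) ℂ) *ᵥ tensorVec N (Pi.single a 1)) := by
    rw [tensorMat_mulVec_tensorVec, hU, tensorVec_smul, smul_smul, ← mul_pow,
      mul_inv_cancel₀ hr0, one_pow, one_smul]
  rw [hwU, Matrix.mulVec_smul, meanCopies_mulVec_tensorMat_mulVec, h0, Matrix.mulVec_smul,
    smul_comm]

/-- A symmetric tensor that is orthogonal to all product vectors vanishes. -/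
theorem eq_zero_of_sum_mul_tensorVec [Nonempty (Fin d)] {y : (Fin N → Fin d) → ℂ}
    (hy : ∀ (π : Equiv.Perm (Fin N)) (i : Fin N → Fin d), y (i ∘ π) = y i)
    (h : ∀ w : Fin d → ℂ, w ≠ 0 → ∑ i, y i * tensorVec N w i = 0) (i : Fin N → Fin d) :
    y i = 0 := by
  classical
  let a : Fin d := Classical.arbitrary _
  let deg : (Fin N → Fin d) → Fin d →₀ ℕ := fun j => Multiset.toFinsupp (Finset.univ.val.map j)
  -- The pairing of y with w^{⊗N} is a polynomial in the coordinates of w. It vanishes whenever all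
  -- coordinates are nonzero, a product of infinite sets, so it is the zero polynomial.
  have hp : ∑ j, MvPolynomial.monomial (deg j) (y j) = 0 := by
    refine MvPolynomial.funext_set (fun _ => {0}ᶜ) (fun _ => (Set.finite_singleton 0).infinite_compl)
      fun w hw => ?_
    have hw0 : w ≠ 0 := fun h0 => hw a trivial (by simp [h0])
    rw [map_sum, map_zero, ← h w hw0]
    refine Finset.sum_congr rfl fun j _ => ?_
    rw [MvPolynomial.eval_monomial, Finsupp.prod_fintype _ _ (by simp)]
    congr 1
    simp only [deg, Multiset.toFinsupp_apply, tensorVec]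
    rw [← Finset.prod_fiberwise Finset.univ j]
    refine Finset.prod_congr rfl fun b _ => ?_
    rw [Multiset.count_map, Finset.prod_congr rfl fun k hk => by
      rw [(Finset.mem_filter.mp hk).2], Finset.prod_const, Finset.card_def, Finset.filter_val]
    simp only [eq_comm]
  have hc := congrArg (MvPolynomial.coeff (deg i)) hp
  rw [MvPolynomial.coeff_sum] at hc
  simp only [MvPolynomial.coeff_monomial, MvPolynomial.coeff_zero] at hc
  -- Words with equal multidegree differ by a permutation, on which y is constant; the coefficient
  -- is therefore a positive integer multiple of `y i`.
  have hterm : ∀ j, (if deg j = deg i then y j else 0) = if deg j = deg i then y i else 0 := by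
    intro j
    split_ifs with hji
    · obtain ⟨π, rfl⟩ := exists_comp_perm_eq (Multiset.toFinsupp.injective hji).symm
      exact hy π i
    · rfl
  simp only [hterm] at hc
  rw [← Finset.sum_filter, Finset.sum_const, smul_eq_zero] at hc
  refine hc.resolve_left (Finset.card_ne_zero.mpr ⟨i, by simp⟩)

theorem boseProj_apply_comp_right (π : Equiv.Perm (Fin N)) (i j : Fin N → Fin d) :
    boseProj d N i (j ∘ π) = boseProj d N i j := by
  have h1 : boseProj d N (j ∘ π) i = boseProj d N j i := by
    have := congrFun (congrFun (permOp_mul_boseProj (d := d) N π) j) i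
    rw [← this, Matrix.mul_apply]
    simp [permOp]
  rw [← (isHermitian_boseProj N).apply i (j ∘ π), h1, (isHermitian_boseProj N).apply]

/-- The mean of `N` copies of a uniformly distributed pure state is the normalized projection onto
the Bose space. -/
theorem meanCopies_uniformPureState (ψ₀ : PureState d) :
    meanCopies N (uniformPureState ψ₀ : Measure (PureState d)) =
      ((boseDim d N : ℂ)⁻¹) • boseProj d N := by
  have : Nonempty (Fin d) := by
    by_contra hd
    have : IsEmpty (Fin d) := not_nonempty_iff.mp hd
    exact ne_zero_of_mem_unit_sphere ψ₀ (Subsingleton.elim _ _)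
  obtain ⟨c, hc⟩ := meanCopies_mulVec_tensorVec N ψ₀
  set X := meanCopies N (uniformPureState ψ₀ : Measure (PureState d)) with hX
  have hXs : ∀ (π : Equiv.Perm (Fin N)) (i j : Fin N → Fin d), X i (j ∘ π) = X i j := by
    intro π i j
    simp only [hX, meanCopies, Matrix.of_apply, PureState.copies_eq_ketbra, ketbra,
      Matrix.vecMulVec_apply, Pi.star_apply, tensorVec_comp_perm]
  -- Each row of the difference is a symmetric tensor that pairs to zero with all nonzero product
  -- vectors.
  have h : X = c • boseProj d N := by
    ext i j
    rw [← sub_eq_zero]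
    refine eq_zero_of_sum_mul_tensorVec N (y := fun j => X i j - (c • boseProj d N) i j)
      (fun π j => ?_) (fun w hw => ?_) j
    · simp [hXs, boseProj_apply_comp_right]
    · have h1 := congrFun (hc w hw) i
      have h2 := congrFun (boseProj_mulVec_tensorVec N w) i
      rw [Pi.smul_apply, ← h2, ← Pi.smul_apply, ← Matrix.smul_mulVec] at h1
      simp only [sub_mul, Finset.sum_sub_distrib]
      exact sub_eq_zero.mpr h1
  have ht := trace_meanCopies N (uniformPureState ψ₀ : Measure (PureState d))
  rw [← hX, h, Matrix.trace_smul, trace_boseProj, smul_eq_mul] at ht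
  rw [h, eq_inv_of_mul_eq_one_left ht]

variable {N} in
-- If the dimension were zero, the mean of the copies would be the zero matrix, yet its trace is 1.
theorem boseDim_ne_zero (ψ₀ : PureState d) : (boseDim d N : ℂ) ≠ 0 := by
  intro h0
  have ht := trace_meanCopies N (uniformPureState ψ₀ : Measure (PureState d))
  rw [meanCopies_uniformPureState, h0, inv_zero, zero_smul, Matrix.trace_zero] at ht
  exact zero_ne_one ht

end MeanCopies

/-! ### Zero-sum games with a bounded payoff -/

section Games

variable {A B : Type*} [MeasurableSpace A] [MeasurableSpace B]

/-- If the pure strategies of player I earn at most `v` against `ξ` and those of player II concede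
at least `v` to `χ`, then `(χ, ξ)` is an equilibrium and `v` is the value. -/
theorem isZeroSumNashEquilibrium_of_pure_bounds {P : A → B → ℝ}
    (hm : Measurable (Function.uncurry P)) (h0 : ∀ a b, 0 ≤ P a b) (h1 : ∀ a b, P a b ≤ 1)
    {χ : ProbabilityMeasure A} {ξ : ProbabilityMeasure B} {v : ℝ}
    (hξ : ∀ a, ∫ b, P a b ∂(ξ : Measure B) ≤ v) (hχ : ∀ b, v ≤ ∫ a, P a b ∂(χ : Measure A)) :
    IsZeroSumNashEquilibrium (expectedPayoff P) χ ξ ∧ expectedPayoff P χ ξ = v ∧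
      HasValue (expectedPayoff P) v := by
  have hint : ∀ (χ : ProbabilityMeasure A) (ξ : ProbabilityMeasure B),
      Integrable (Function.uncurry P) ((χ : Measure A).prod (ξ : Measure B)) := fun χ ξ =>
    Integrable.of_bound hm.aestronglyMeasurable 1 (Filter.Eventually.of_forall fun p => by
      rw [Function.uncurry, Real.norm_eq_abs, abs_of_nonneg (h0 _ _)]
      exact h1 _ _)
  have hle : ∀ χ', expectedPayoff P χ' ξ ≤ v := by
    intro χ'
    have h : expectedPayoff P χ' ξ = ∫ a, ∫ b, P a b ∂(ξ : Measure B) ∂(χ' : Measure A) :=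
      integral_prod _ (hint χ' ξ)
    rw [h]
    calc ∫ a, ∫ b, P a b ∂(ξ : Measure B) ∂(χ' : Measure A)
        ≤ ∫ _, v ∂(χ' : Measure A) :=
          integral_mono (hint χ' ξ).integral_prod_left (integrable_const v) hξ
      _ = v := by simp
  have hge : ∀ ξ', v ≤ expectedPayoff P χ ξ' := by
    intro ξ'
    have h : expectedPayoff P χ ξ' = ∫ b, ∫ a, P a b ∂(χ : Measure A) ∂(ξ' : Measure B) :=
      integral_prod_symm _ (hint χ ξ')
    rw [h]
    calc v = ∫ _, v ∂(ξ' : Measure B) := by simp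
      _ ≤ ∫ b, ∫ a, P a b ∂(χ : Measure A) ∂(ξ' : Measure B) :=
          integral_mono (integrable_const v) (hint χ ξ').integral_prod_right hχ
  have heq : expectedPayoff P χ ξ = v := le_antisymm (hle χ) (hge ξ)
  have hbound : ∀ χ' ξ', 0 ≤ expectedPayoff P χ' ξ' ∧ expectedPayoff P χ' ξ' ≤ 1 := by
    intro χ' ξ'
    -- Boundedness is needed because suprema and infima in ℝ carry no information for unbounded
    -- families.
    refine ⟨integral_nonneg fun p => h0 _ _, ?_⟩
    calc expectedPayoff P χ' ξ' ≤ ∫ _, (1 : ℝ) ∂((χ' : Measure A).prod (ξ' : Measure B)) :=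
          integral_mono (hint χ' ξ') (integrable_const 1) fun p => h1 _ _
      _ = 1 := by simp
  have hbelow : ∀ χ', BddBelow (Set.range fun ξ' => expectedPayoff P χ' ξ') := fun χ' =>
    ⟨0, by rintro _ ⟨ξ', rfl⟩; exact (hbound χ' ξ').1⟩
  have habove : ∀ ξ', BddAbove (Set.range fun χ' => expectedPayoff P χ' ξ') := fun ξ' =>
    ⟨1, by rintro _ ⟨χ', rfl⟩; exact (hbound χ' ξ').2⟩
  have : Nonempty (ProbabilityMeasure A) := ⟨χ⟩
  have : Nonempty (ProbabilityMeasure B) := ⟨ξ⟩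
  refine ⟨⟨fun χ' => (hle χ').trans heq.ge, fun ξ' => neg_le_neg (heq.le.trans (hge ξ'))⟩, heq,
    le_antisymm (ciSup_le fun χ' => (ciInf_le (hbelow χ') ξ).trans (hle χ')) ?_,
    le_antisymm ?_ (le_ciInf fun ξ' => (hge ξ').trans (le_ciSup (habove ξ') χ))⟩
  · refine (le_ciInf hge).trans (le_ciSup (f := fun χ' => ⨅ ξ', expectedPayoff P χ' ξ')
      ⟨v, ?_⟩ χ)
    rintro _ ⟨χ', rfl⟩
    exact (ciInf_le (hbelow χ') ξ).trans (hle χ')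
  · refine (ciInf_le (f := fun ξ' => ⨆ χ', expectedPayoff P χ' ξ') ⟨v, ?_⟩ ξ).trans
      (ciSup_le hle)
    rintro _ ⟨ξ', rfl⟩
    exact (hge ξ').trans (le_ciSup (habove ξ') χ)

end Games

/-! ### The SWAP test -/

section Swap

variable {n : Type*} [Fintype n] [DecidableEq n]

theorem trace_swapOp_mul_kronecker (ρ σ : Matrix n n ℂ) :
    (swapOp n * (ρ ⊗ₖ σ)).trace = (ρ * σ).trace := by
  simp only [Matrix.trace, Matrix.diag_apply, Matrix.mul_apply, swapOp, Matrix.of_apply,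
    Matrix.kroneckerMap_apply, Fintype.sum_prod_type, ite_and, ite_mul, one_mul, zero_mul]
  rw [Finset.sum_comm]
  simp

/-- The pass probability is p = (1 + Re tr ρσ)/2, and the payoffs ±1 have mean 2p − 1. -/
theorem swapTestPayoff_eq {ρ σ : Matrix n n ℂ} (hρ : ρ.trace = 1) (hσ : σ.trace = 1) :
    swapTestPayoff ρ σ = (ρ * σ).trace.re := by
  have h : swapTestPassProb ρ σ = (1 + (ρ * σ).trace.re) / 2 := by
    rw [swapTestPassProb, Matrix.smul_mul, add_mul, one_mul, Matrix.trace_smul, Matrix.trace_add,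
      trace_swapOp_mul_kronecker, Matrix.trace_kronecker, hρ, hσ, smul_eq_mul]
    simp [Complex.mul_re]
    ring
  rw [swapTestPayoff, h]
  ring

theorem swapTestPayoff_mem_Icc {ρ σ : Matrix n n ℂ} (hρ : ρ.PosSemidef) (hρ1 : ρ.trace = 1)
    (hσ : σ.IsHermitian) (hσ2 : σ * σ = σ) (hσ1 : σ.trace = 1) :
    0 ≤ swapTestPayoff ρ σ ∧ swapTestPayoff ρ σ ≤ 1 := by
  rw [swapTestPayoff_eq hρ1 hσ1]
  have h0 := (Complex.le_def.mp (trace_mul_projection_nonneg hρ hσ hσ2)).1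
  have h1 := (Complex.le_def.mp (trace_mul_projection_le hρ hσ hσ2)).1
  rw [hρ1] at h1
  exact ⟨by simpa using h0, by simpa using h1⟩

end Swap

/-! ### The estimation game -/

section Estimation

variable {d N : ℕ}

theorem PureState.isHermitian_density (ψ : PureState d) : ψ.density.IsHermitian :=
  ketbra_isHermitian _

theorem PureState.posSemidef_density (ψ : PureState d) : ψ.density.PosSemidef :=
  posSemidef_of_projection ψ.isHermitian_density ψ.density_mul_self

theorem Measurement.posSemidef_effect {R : ℕ} (S : Measurement d N R) (r : Fin R) :
    (S.effect r).PosSemidef := S.2.1 r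

theorem Measurement.sum_effect {R : ℕ} (S : Measurement d N R) : ∑ r, S.effect r = 1 := S.2.2

theorem trace_effect_mul_copies_nonneg {R : ℕ} (S : Measurement d N R) (r : Fin R)
    (ψ : PureState d) : 0 ≤ (S.effect r * ψ.copies N).trace :=
  trace_mul_projection_nonneg (S.posSemidef_effect r) (ψ.isHermitian_copies N)
    (ψ.copies_mul_self N)

theorem trace_output (S : EstimationStrategy d N) (ψ : PureState d) :
    (S.output (ψ.copies N)).trace = 1 := by
  rw [EstimationStrategy.output, Matrix.trace_sum]
  simp only [Matrix.trace_smul, PureState.trace_density, smul_eq_mul, mul_one]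
  rw [← Matrix.trace_sum, ← Finset.sum_mul, S.2.sum_effect, one_mul, ψ.trace_copies]

theorem posSemidef_output (S : EstimationStrategy d N) (ψ : PureState d) :
    (S.output (ψ.copies N)).PosSemidef :=
  Matrix.posSemidef_sum _ fun r _ =>
    (S.2.guess r).posSemidef_density.smul (trace_effect_mul_copies_nonneg S.2 r ψ)

theorem estimationPayoff_mem_Icc (S : EstimationStrategy d N) (ψ : PureState d) :
    0 ≤ estimationPayoff d N S ψ ∧ estimationPayoff d N S ψ ≤ 1 :=
  swapTestPayoff_mem_Icc (posSemidef_output S ψ) (trace_output S ψ) ψ.isHermitian_density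
    ψ.density_mul_self ψ.trace_density

theorem estimationPayoff_eq (S : EstimationStrategy d N) (ψ : PureState d) :
    estimationPayoff d N S ψ = (∑ r, (S.2.effect r * ψ.copies N).trace *
      ((S.2.guess r).density * ψ.density).trace).re := by
  rw [estimationPayoff, swapTestPayoff_eq (trace_output S ψ) ψ.trace_density,
    EstimationStrategy.output, Finset.sum_mul, Matrix.trace_sum]
  simp only [Matrix.smul_mul, Matrix.trace_smul, smul_eq_mul]

theorem PureState.copies_one_eq (φ ψ : PureState d) :
    (φ.density * ψ.density).trace = (φ.copies 1 * ψ.copies 1).trace := by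
  rw [trace_copies_mul_copies, pow_one]

/-- The overlap with the guess uses one more copy of ψ, so each outcome's score becomes linear in N
+ 1 copies. -/
theorem trace_tensorMul_mul_copies (A : TensorOp d N) (φ ψ : PureState d) :
    (A * ψ.copies N).trace * (φ.density * ψ.density).trace =
      (tensorMul A (φ.copies 1) * ψ.copies (N + 1)).trace := by
  rw [ψ.copies_add, tensorMul_mul_tensorMul, trace_tensorMul, PureState.copies_one_eq]

theorem trace_boseProj_mul_mul_copies (A : TensorOp d N) (ψ : PureState d) :
    (boseProj d N * A * boseProj d N * ψ.copies N).trace = (A * ψ.copies N).trace := by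
  rw [mul_assoc, boseProj_mul_copies, mul_assoc, Matrix.trace_mul_comm, mul_assoc,
    copies_mul_boseProj]

theorem continuous_density (i j : Fin d) : Continuous fun ψ : PureState d => ψ.density i j := by
  simp only [PureState.density, ketbra, Matrix.vecMulVec_apply, Pi.star_apply]
  fun_prop

/-- The strategy enters the payoff only through these numbers. Measurability on the disjoint union
over R is checked for each number of outcomes separately. -/
theorem measurable_effect_mul_density (i j : Fin N → Fin d) (a b : Fin d) :
    Measurable fun S : EstimationStrategy d N =>
      ∑ r, S.2.effect r i j * (S.2.guess r).density a b := by
  refine fun s hs => MeasurableSpace.measurableSet_iInf.mpr fun R => ?_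
  have h : Measurable fun S : Measurement d N R =>
      ∑ r, S.effect r i j * (S.guess r).density a b := by
    refine Finset.measurable_fun_sum _ fun r _ => Measurable.mul ?_ ?_
    · exact (measurable_pi_apply j).comp ((measurable_pi_apply i).comp
        ((measurable_pi_apply r).comp (measurable_fst.comp measurable_subtype_coe)))
    · exact (continuous_density a b).measurable.comp
        ((measurable_pi_apply r).comp (measurable_snd.comp measurable_subtype_coe))
  exact h hs

theorem measurable_estimationPayoff :
    Measurable (Function.uncurry (estimationPayoff d N)) := by
  -- Moving the sum over outcomes innermost leaves outer sums whose index sets do not depend on the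
  -- strategy, and separates the two players' variables.
  have h : Function.uncurry (estimationPayoff d N) = fun p => (∑ i, ∑ j, ∑ a, ∑ b,
      (∑ r, p.1.2.effect r i j * (p.1.2.guess r).density a b) *
        (p.2.copies N j i * p.2.density b a)).re := by
    funext p
    rw [Function.uncurry, estimationPayoff_eq]
    congr 1
    simp only [Matrix.trace, Matrix.diag_apply, Matrix.mul_apply]
    simp_rw [Finset.sum_mul]
    simp_rw [Finset.mul_sum]
    refine Finset.sum_comm.trans (Finset.sum_congr rfl fun i _ => Finset.sum_comm.trans
      (Finset.sum_congr rfl fun j _ => Finset.sum_comm.trans (Finset.sum_congr rfl fun a _ =>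
        Finset.sum_comm.trans (Finset.sum_congr rfl fun b _ => Finset.sum_congr rfl fun r _ => ?_))))
    ring
  rw [h]
  refine Complex.measurable_re.comp ?_
  refine Finset.measurable_fun_sum _ fun i _ => Finset.measurable_fun_sum _ fun j _ =>
    Finset.measurable_fun_sum _ fun a _ => Finset.measurable_fun_sum _ fun b _ => ?_
  exact ((measurable_effect_mul_density i j a b).comp measurable_fst).mul
    ((((continuous_copies N j i).mul (continuous_density b a)).measurable).comp measurable_snd)

theorem measurable_estimationPayoff_left (ψ : PureState d) :
    Measurable fun S : EstimationStrategy d N => estimationPayoff d N S ψ :=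
  measurable_estimationPayoff.of_uncurry_right

/-- No estimation strategy earns more than `d[N]/d[N+1]` on average. -/
theorem integral_estimationPayoff_le (S : EstimationStrategy d N) (ψ₀ : PureState d) :
    ∫ ψ, estimationPayoff d N S ψ ∂(uniformPureState ψ₀ : Measure (PureState d)) ≤
      (boseDim d N : ℝ) / (boseDim d (N + 1) : ℝ) := by
  -- Compressing the effects by s_N leaves the payoff unchanged and lowers the total trace from that
  -- of the whole tensor power to d[N].
  set B : TensorOp d (N + 1) := ∑ r, tensorMul (boseProj d N * S.2.effect r * boseProj d N)
    ((S.2.guess r).copies 1) with hB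
  have hpos : B.PosSemidef := Matrix.posSemidef_sum _ fun r _ => posSemidef_tensorMul (by
    have := (S.2.posSemidef_effect r).mul_mul_conjTranspose_same (boseProj d N)
    rwa [(isHermitian_boseProj N).eq] at this) (PureState.posSemidef_copies _ _)
  have htr : B.trace = boseDim d N := by
    rw [hB, Matrix.trace_sum]
    simp only [trace_tensorMul, PureState.trace_copies, mul_one]
    rw [← Matrix.trace_sum, ← Finset.sum_mul, ← Finset.mul_sum, S.2.sum_effect, mul_one,
      boseProj_mul_self, trace_boseProj]
  have hpay : ∀ ψ : PureState d,
      estimationPayoff d N S ψ = (B * ψ.copies (N + 1)).trace.re := by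
    intro ψ
    rw [estimationPayoff_eq, hB, Finset.sum_mul, Matrix.trace_sum]
    simp only [← trace_tensorMul_mul_copies, trace_boseProj_mul_mul_copies]
  simp only [hpay]
  rw [integral_re_trace_mul_copies, meanCopies_uniformPureState, Matrix.mul_smul,
    Matrix.trace_smul, smul_eq_mul]
  have h := (Complex.le_def.mp (trace_mul_projection_le hpos (isHermitian_boseProj (N + 1))
    (boseProj_mul_self (N + 1)))).1
  rw [htr, Complex.natCast_re] at h
  rw [← Complex.ofReal_natCast, ← Complex.ofReal_inv, Complex.re_ofReal_mul, div_eq_inv_mul]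
  exact mul_le_mul_of_nonneg_left h (by positivity)

end Estimation

/-! ### The cloning game -/

section Cloning

/-- This is complete positivity with a one-dimensional ancilla. -/
theorem Channel.posSemidef_map {m n : Type*} [Fintype m] [Fintype n] (T : Channel m n)
    {X : Matrix m m ℂ} (hX : X.PosSemidef) : (T.map X).PosSemidef :=
  (T.completelyPositive 1 (X.submatrix Prod.snd Prod.snd) (hX.submatrix _)).submatrix
    fun i => ((0 : Fin 1), i)

variable {d N M : ℕ}

theorem cloningPayoff_eq (T : CloningStrategy d N M) (ψ : PureState d) :
    cloningPayoff d N M T ψ = (T.map (ψ.copies N) * ψ.copies M).trace.re :=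
  swapTestPayoff_eq (by rw [T.trace_map, ψ.trace_copies]) (ψ.trace_copies M)

theorem cloningPayoff_mem_Icc (T : CloningStrategy d N M) (ψ : PureState d) :
    0 ≤ cloningPayoff d N M T ψ ∧ cloningPayoff d N M T ψ ≤ 1 :=
  swapTestPayoff_mem_Icc (T.posSemidef_map (ψ.posSemidef_copies N))
    (by rw [T.trace_map, ψ.trace_copies]) (ψ.isHermitian_copies M) (ψ.copies_mul_self M)
    (ψ.trace_copies M)

theorem Channel.measurable_map_apply {m n : Type*} [Fintype m] [Fintype n] (X : Matrix m m ℂ)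
    (a b : n) : Measurable fun T : Channel m n => T.map X a b :=
  (measurable_pi_apply b).comp ((measurable_pi_apply a).comp
    ((measurable_pi_apply X).comp (comap_measurable _)))

theorem measurable_cloningPayoff : Measurable (Function.uncurry (cloningPayoff d N M)) := by
  have h : Function.uncurry (cloningPayoff d N M) = fun p => (∑ a, ∑ b, (∑ i, ∑ j,
      p.2.copies N i j * p.1.map (Matrix.single i j 1) a b) * p.2.copies M b a).re := by
    funext p
    rw [Function.uncurry, cloningPayoff_eq]
    congr 1
    simp only [Matrix.trace, Matrix.diag_apply, Matrix.mul_apply]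
    refine Finset.sum_congr rfl fun a _ => Finset.sum_congr rfl fun b _ => ?_
    congr 1
    -- Expanding the input in matrix units means that T is evaluated only on fixed operators, as the
    -- generated σ-algebra requires, although the input varies with ψ.
    conv_lhs => rw [Matrix.matrix_eq_sum_single (p.2.copies N)]
    simp only [map_sum, Matrix.sum_apply]
    refine Finset.sum_congr rfl fun i _ => Finset.sum_congr rfl fun j _ => ?_
    rw [← mul_one (p.2.copies N i j), ← smul_eq_mul, ← Matrix.smul_single, map_smul]
    simp
  rw [h]
  refine Complex.measurable_re.comp ?_
  refine Finset.measurable_fun_sum _ fun a _ => Finset.measurable_fun_sum _ fun b _ =>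
    Measurable.mul (Finset.measurable_fun_sum _ fun i _ => Finset.measurable_fun_sum _ fun j _ => ?_)
      ((continuous_copies M b a).measurable.comp measurable_snd)
  exact ((continuous_copies N i j).measurable.comp measurable_snd).mul
    ((Channel.measurable_map_apply _ a b).comp measurable_fst)

/-- No cloning device earns more than `d[N]/d[M]` on average. -/
theorem integral_cloningPayoff_le (T : CloningStrategy d N M) (ψ₀ : PureState d) :
    ∫ ψ, cloningPayoff d N M T ψ ∂(uniformPureState ψ₀ : Measure (PureState d)) ≤
      (boseDim d N : ℝ) / (boseDim d M : ℝ) := by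
  -- Enlarging the input to s_N makes it independent of ψ, so only the M target copies remain to be
  -- averaged.
  have hle : ∀ ψ : PureState d, cloningPayoff d N M T ψ ≤
      (T.map (boseProj d N) * ψ.copies M).trace.re := by
    intro ψ
    have h := trace_mul_projection_nonneg
      (T.posSemidef_map (posSemidef_boseProj_sub_copies N ψ)) (ψ.isHermitian_copies M)
      (ψ.copies_mul_self M)
    rw [map_sub, sub_mul, Matrix.trace_sub, sub_nonneg] at h
    rw [cloningPayoff_eq]
    exact (Complex.le_def.mp h).1
  have hint : Integrable (cloningPayoff d N M T)
      (uniformPureState ψ₀ : Measure (PureState d)) :=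
    Integrable.of_bound measurable_cloningPayoff.of_uncurry_left.aestronglyMeasurable
      1 (Filter.Eventually.of_forall fun ψ => by
        rw [Real.norm_eq_abs, abs_of_nonneg (cloningPayoff_mem_Icc T ψ).1]
        exact (cloningPayoff_mem_Icc T ψ).2)
  refine (integral_mono hint (integrable_trace_mul_copies M _ _).re hle).trans ?_
  refine (integral_re_trace_mul_copies M _ _).le.trans ?_
  rw [meanCopies_uniformPureState, Matrix.mul_smul, Matrix.trace_smul, smul_eq_mul]
  have h := (Complex.le_def.mp (trace_mul_projection_le (T.posSemidef_map (posSemidef_boseProj N))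
    (isHermitian_boseProj M) (boseProj_mul_self M))).1
  rw [T.trace_map, trace_boseProj, Complex.natCast_re] at h
  rw [← Complex.ofReal_natCast, ← Complex.ofReal_inv, Complex.re_ofReal_mul, div_eq_inv_mul]
  exact mul_le_mul_of_nonneg_left h (by positivity)

/-- Both factors s_M are absorbed by ψ^{⊗M}, and tr((ψ^{⊗N} ⊗ 1) ψ^{⊗M}) = 1. The payoff is the same
for every ψ. -/
theorem cloningPayoff_of_isWernerCloner {h : N ≤ M} {T : CloningStrategy d N M}
    (hT : IsWernerCloner h T) (ψ : PureState d) :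
    cloningPayoff d N M T ψ = (boseDim d N : ℝ) / (boseDim d M : ℝ) := by
  obtain ⟨K, rfl⟩ := Nat.exists_eq_add_of_le h
  rw [cloningPayoff_eq, hT _ (by rw [boseProj_mul_copies, copies_mul_boseProj]), Matrix.smul_mul,
    Matrix.trace_smul, mul_assoc, boseProj_mul_copies, mul_assoc, Matrix.trace_mul_comm, mul_assoc,
    copies_mul_boseProj, tensorIdentity_eq_tensorMul, ψ.copies_add, tensorMul_mul_tensorMul,
    one_mul, ψ.copies_mul_self, trace_tensorMul, ψ.trace_copies, ψ.trace_copies]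
  simp only [mul_one, smul_eq_mul]
  rw [← Complex.ofReal_natCast, ← Complex.ofReal_natCast, ← Complex.ofReal_div, Complex.ofReal_re]

theorem isZeroSumNashEquilibrium_of_isWernerCloner {h : N ≤ M} {T : CloningStrategy d N M}
    (hT : IsWernerCloner h T) (ψ₀ : PureState d) :
    IsZeroSumNashEquilibrium (expectedPayoff (cloningPayoff d N M)) (pureAsMixed T)
        (uniformPureState ψ₀) ∧
      expectedPayoff (cloningPayoff d N M) (pureAsMixed T) (uniformPureState ψ₀) =
        (boseDim d N : ℝ) / (boseDim d M : ℝ) ∧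
      HasValue (expectedPayoff (cloningPayoff d N M))
        ((boseDim d N : ℝ) / (boseDim d M : ℝ)) := by
  refine isZeroSumNashEquilibrium_of_pure_bounds measurable_cloningPayoff
    (fun T ψ => (cloningPayoff_mem_Icc T ψ).1) (fun T ψ => (cloningPayoff_mem_Icc T ψ).2)
    (fun T => integral_cloningPayoff_le T ψ₀) fun ψ => ?_
  rw [pureAsMixed, ProbabilityMeasure.coe_mk, integral_dirac'
    (fun T => cloningPayoff d N M T ψ) _
    measurable_cloningPayoff.of_uncurry_right.stronglyMeasurable,
    cloningPayoff_of_isWernerCloner hT]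

end Cloning

/-! ### Finite averages -/

section Caratheodory

variable {E : Type*} [NormedAddCommGroup E] [NormedSpace ℝ E] [FiniteDimensional ℝ E]

/-- By Carathéodory at most dim E + 1 points are needed, so the hull is a finite union of continuous
images of a simplex times a power of s. -/
theorem isCompact_convexHull {s : Set E} (hs : IsCompact s) : IsCompact (convexHull ℝ s) := by
  have h : convexHull ℝ s = ⋃ n ∈ Finset.range (Module.finrank ℝ E + 2),
      (fun p : (Fin n → ℝ) × (Fin n → E) => ∑ i, p.1 i • p.2 i) ''
        (stdSimplex ℝ (Fin n) ×ˢ Set.pi Set.univ fun _ => s) := by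
    apply Set.Subset.antisymm
    · intro x hx
      obtain ⟨ι, _, z, w, hz, hind, hw, hw1, rfl⟩ := eq_pos_convex_span_of_mem_convexHull hx
      have hcard : Fintype.card ι ≤ Module.finrank ℝ E + 1 :=
        hind.card_le_finrank_succ.trans (Nat.succ_le_succ (Submodule.finrank_le _))
      let e := (Fintype.equivFin ι).symm
      refine Set.mem_biUnion (x := Fintype.card ι) (Finset.mem_range.mpr (by omega))
        ⟨(w ∘ e, z ∘ e), ⟨⟨fun i => (hw _).le, ?_⟩, fun i _ => hz ⟨_, rfl⟩⟩, ?_⟩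
      · exact (Equiv.sum_comp e w).trans hw1
      · exact Equiv.sum_comp e fun i => w i • z i
    · refine Set.iUnion₂_subset fun n _ => ?_
      rintro _ ⟨⟨w, z⟩, ⟨⟨hw, hw1⟩, hz⟩, rfl⟩
      exact (convex_convexHull ℝ s).sum_mem (fun i _ => hw i) hw1
        fun i _ => subset_convexHull ℝ s (hz i trivial)
  rw [h]
  refine Finset.isCompact_biUnion _ fun n _ => ?_
  refine ((isCompact_stdSimplex ℝ (Fin n)).prod (isCompact_univ_pi fun _ => hs)).image ?_
  fun_prop

/-- The mean of a continuous function on a compact space is a finite average of its values. -/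
theorem exists_finite_average {X : Type*} [TopologicalSpace X] [CompactSpace X]
    [MeasurableSpace X] [BorelSpace X] (μ : Measure X) [IsProbabilityMeasure μ] {f : X → E}
    (hf : Continuous f) (hint : Integrable f μ) :
    ∃ (R : ℕ) (w : Fin R → ℝ) (x : Fin R → X), (∀ r, 0 ≤ w r) ∧
      ∫ y, f y ∂μ = ∑ r, w r • f (x r) := by
  -- The mean lies in the closed convex hull of the values; by compactness the hull itself is
  -- closed, so a finite combination is attained.
  have hmem := (convex_convexHull ℝ (Set.range f)).integral_mem (μ := μ) (f := f)
    (isCompact_convexHull (isCompact_range hf)).isClosed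
    (Filter.Eventually.of_forall fun y => subset_convexHull ℝ _ ⟨y, rfl⟩) hint
  obtain ⟨ι, _, w, z, hw, -, hz, hsum⟩ := mem_convexHull_iff_exists_fintype.mp hmem
  choose x hx using hz
  let e := (Fintype.equivFin ι).symm
  refine ⟨Fintype.card ι, w ∘ e, x ∘ e, fun r => hw _, ?_⟩
  rw [← hsum, ← Equiv.sum_comp e]
  simp [hx]

end Caratheodory

/-- A finite average reproduces the uniform mean s_N/d[N]; rescaling the weights by d[N] gives a
finite resolution of s_N into product states. -/
theorem exists_sum_smul_copies_eq_boseProj {d : ℕ} (N : ℕ) (ψ₀ : PureState d) :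
    ∃ (R : ℕ) (c : Fin R → ℝ) (φ : Fin R → PureState d), (∀ r, 0 ≤ c r) ∧
      ∑ r, (c r : ℂ) • (φ r).copies N = boseProj d N := by
  let f : PureState d → (Fin N → Fin d) × (Fin N → Fin d) → ℂ := fun ψ p => ψ.copies N p.1 p.2
  have hf : Continuous f := continuous_pi fun p => continuous_copies N p.1 p.2
  have hint : Integrable f (uniformPureState ψ₀ : Measure (PureState d)) :=
    hf.integrable_of_hasCompactSupport (HasCompactSupport.of_compactSpace _)
  have hfp : ∀ p, Integrable (fun ψ => f ψ p) (uniformPureState ψ₀ : Measure (PureState d)) :=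
    fun p => ((continuous_apply p).comp hf).integrable_of_hasCompactSupport
      (HasCompactSupport.of_compactSpace _)
  obtain ⟨R, w, φ, hw, h⟩ := exists_finite_average _ hf hint
  refine ⟨R, fun r => boseDim d N * w r, φ, fun r => by have := hw r; positivity, ?_⟩
  have hmean : meanCopies N (uniformPureState ψ₀ : Measure (PureState d)) =
      ∑ r, (w r : ℂ) • (φ r).copies N := by
    ext i j
    have h1 := congrFun h (i, j)
    rw [eval_integral hfp] at h1
    rw [meanCopies, Matrix.of_apply, Matrix.sum_apply]
    refine h1.trans ?_
    rw [Finset.sum_apply]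
    rfl
  rw [meanCopies_uniformPureState] at hmean
  simp only [Complex.ofReal_mul, ← smul_smul]
  rw [← Finset.smul_sum, ← hmean, Complex.ofReal_natCast, smul_smul,
    mul_inv_cancel₀ (boseDim_ne_zero ψ₀), one_smul]

/-! ### Coherent measurements on qubits -/

section Qubits

variable {N : ℕ}

theorem boseDim_two (N : ℕ) : boseDim 2 N = N + 1 := by
  rw [boseDim, show 2 + N - 1 = N + 1 by omega, Nat.choose_succ_self_right]

/-- The coefficient of `|N/2, m⟩` in a spin coherent state. -/
def coherentCoeff (N : ℕ) (η θ : ℝ) (k : Fin (N + 1)) : ℂ :=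
  Complex.exp (-Complex.I * η * (spinM N k : ℂ)) * (wignerD N k θ : ℂ)

/-- The coefficient matrix has rank one, which is why each effect is a multiple of a projection onto
a coherent state. -/
theorem effectCoeff_eq (c η θ : ℝ) (k l : Fin (N + 1)) :
    effectCoeff N c η θ k l = c * (coherentCoeff N η θ k * star (coherentCoeff N η θ l)) := by
  have h : star (Complex.exp (-Complex.I * η * (spinM N l : ℂ))) =
      Complex.exp (Complex.I * η * (spinM N l : ℂ)) := by
    rw [Complex.star_def, ← Complex.exp_conj]
    simp
  rw [effectCoeff, coherentCoeff, coherentCoeff, star_mul', h, Complex.star_def,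
    Complex.conj_ofReal, show -Complex.I * η * ((spinM N k - spinM N l : ℝ) : ℂ) =
      -Complex.I * η * (spinM N k : ℂ) + Complex.I * η * (spinM N l : ℂ) by push_cast; ring,
    Complex.exp_add]
  ring

theorem ketbra_sum_smul {n ι : Type*} [Fintype ι] (a : ι → ℂ) (s : ι → n → ℂ) :
    ketbra (∑ k, a k • s k) = ∑ k, ∑ l, (a k * star (a l)) • Matrix.vecMulVec (s k) (star (s l)) := by
  ext i j
  simp only [ketbra, Matrix.vecMulVec_apply, Matrix.sum_apply, Finset.sum_apply, Pi.smul_apply,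
    Pi.star_apply, star_sum, Finset.sum_mul_sum, Matrix.smul_apply, smul_eq_mul, star_mul']
  refine Finset.sum_congr rfl fun k _ => Finset.sum_congr rfl fun l _ => ?_
  ring

theorem sum_effectCoeff_smul (c η θ : ℝ) (φ : PureState 2)
    (h : tensorVec N (φ : EuclideanSpace ℂ (Fin 2)).ofLp =
      ∑ k, coherentCoeff N η θ k • spinState N k) :
    ∑ k, ∑ l, effectCoeff N c η θ k l •
      Matrix.vecMulVec (spinState N k) (star (spinState N l)) = (c : ℂ) • φ.copies N := by
  rw [φ.copies_eq_ketbra, h, ketbra_sum_smul]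
  simp only [Finset.smul_sum, smul_smul, effectCoeff_eq]

/-- This is the binomial expansion of (sin² + cos²)^N. -/
theorem sum_wignerD_sq (θ : ℝ) : ∑ k : Fin (N + 1), wignerD N k θ ^ 2 = 1 := by
  have h := add_pow (Real.sin (θ / 2) ^ 2) (Real.cos (θ / 2) ^ 2) N
  rw [Real.sin_sq_add_cos_sq, one_pow] at h
  rw [h, ← Fin.sum_univ_eq_sum_range (fun k => (Real.sin (θ / 2) ^ 2) ^ k *
    (Real.cos (θ / 2) ^ 2) ^ (N - k) * (N.choose k : ℝ))]
  refine Finset.sum_congr rfl fun k _ => ?_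
  rw [wignerD, mul_pow, mul_pow, Real.sq_sqrt (by positivity)]
  ring

theorem star_coherentCoeff_mul_self (η θ : ℝ) (k : Fin (N + 1)) :
    coherentCoeff N η θ k * star (coherentCoeff N η θ k) = ((wignerD N k θ ^ 2 : ℝ) : ℂ) := by
  have h := effectCoeff_eq (N := N) 1 η θ k k
  rw [effectCoeff, sub_self] at h
  simp only [Complex.ofReal_one, one_mul, Complex.ofReal_zero, mul_zero, Complex.exp_zero] at h
  rw [← h]
  push_cast
  ring

/-- The elements of a coherent measurement are multiples of the guessed states. -/
theorem IsCoherentMeasurement.exists_weights {R : ℕ} {S : Measurement 2 N (R + 1)}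
    (hS : IsCoherentMeasurement S) : ∃ c : Fin R → ℝ, (∀ r, 0 ≤ c r) ∧ ∑ r, c r = N + 1 ∧
      ∀ r, S.effect r.castSucc = (c r : ℂ) • (S.guess r.castSucc).copies N := by
  obtain ⟨c, η, θ, hc, hsum, heff, hguess⟩ := hS
  refine ⟨c, hc, ?_, fun r => ?_⟩
  · have h : ∑ k, ∑ r, effectCoeff N (c r) (η r) (θ r) k k = ((N + 1 : ℕ) : ℂ) := by
      simp [hsum]
    rw [Finset.sum_comm] at h
    simp only [effectCoeff_eq, star_coherentCoeff_mul_self] at h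
    simp only [← Finset.mul_sum, ← Complex.ofReal_sum, sum_wignerD_sq] at h
    simp only [Complex.ofReal_one, mul_one] at h
    exact_mod_cast h
  · rw [heff]
    exact sum_effectCoeff_smul _ _ _ _ (hguess r)

/-- Effect and guess contribute the same overlap, to the powers N and 1. The completing outcome has
a nonnegative contribution whatever its guess, so it can be dropped from a lower bound. -/
theorem estimationPayoff_rotate_ge {R : ℕ} {S : Measurement 2 N (R + 1)} {c : Fin R → ℝ}
    (hc : ∀ r, S.effect r.castSucc = (c r : ℂ) • (S.guess r.castSucc).copies N)
    (U : Matrix.unitaryGroup (Fin 2) ℂ) (ψ : PureState 2) :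
    ∑ r, c r * (ψ.copies (N + 1) * (act U (S.guess r.castSucc)).copies (N + 1)).trace.re ≤
      estimationPayoff 2 N ⟨R + 1, S.rotate U⟩ ψ := by
  have hlast : 0 ≤ ((S.rotate U).effect (Fin.last R) * ψ.copies N).trace *
      (((S.rotate U).guess (Fin.last R)).density * ψ.density).trace :=
    mul_nonneg (trace_effect_mul_copies_nonneg _ _ _) (trace_mul_projection_nonneg
      (PureState.posSemidef_density _) ψ.isHermitian_density ψ.density_mul_self)
  rw [estimationPayoff_eq, Fin.sum_univ_castSucc, Complex.add_re]
  refine le_add_of_le_of_nonneg (le_of_eq ?_) (Complex.le_def.mp hlast).1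
  rw [Complex.re_sum]
  refine Finset.sum_congr rfl fun r _ => ?_
  have heff : (S.rotate U).effect r.castSucc = (c r : ℂ) • (act U (S.guess r.castSucc)).copies N := by
    rw [copies_act, ← Matrix.smul_mul, ← Matrix.mul_smul, ← hc]
    rfl
  rw [heff, Matrix.smul_mul, Matrix.trace_smul, smul_eq_mul, mul_assoc, Complex.re_ofReal_mul,
    Matrix.trace_mul_comm, trace_copies_mul_copies, pow_succ, ← trace_copies_mul_copies]
  rfl

theorem continuous_re_trace_mul_copies_act {d : ℕ} (A : TensorOp d N) (φ : PureState d) :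
    Continuous fun U : Matrix.unitaryGroup (Fin d) ℂ => (A * (act U φ).copies N).trace.re :=
  Complex.continuous_re.comp (Continuous.matrix_trace (continuous_const.mul
    ((continuous_copies_matrix N).comp (continuous_act φ))))

theorem integrable_re_trace_mul_copies_act {d : ℕ} (A : TensorOp d N) (φ : PureState d) :
    Integrable (fun U : Matrix.unitaryGroup (Fin d) ℂ => (A * (act U φ).copies N).trace.re)
      (haarUnitary d : Measure (Matrix.unitaryGroup (Fin d) ℂ)) :=
  (continuous_re_trace_mul_copies_act A φ).integrable_of_hasCompactSupport
    (HasCompactSupport.of_compactSpace _)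

/-- Under Haar-random U the state Uφ is uniform, and s_N fixes the copies of ψ. -/
theorem integral_re_trace_copies_mul_copies_act {d : ℕ} (φ ψ : PureState d) :
    ∫ U : Matrix.unitaryGroup (Fin d) ℂ, (ψ.copies N * (act U φ).copies N).trace.re
      ∂(haarUnitary d : Measure (Matrix.unitaryGroup (Fin d) ℂ)) = (boseDim d N : ℝ)⁻¹ := by
  have hcont : Continuous fun χ : PureState d => (ψ.copies N * χ.copies N).trace.re :=
    Complex.continuous_re.comp (Continuous.matrix_trace (continuous_const.mul
      (continuous_copies_matrix N)))
  rw [← integral_map (f := fun χ : PureState d => (ψ.copies N * χ.copies N).trace.re)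
      (continuous_act φ).measurable.aemeasurable hcont.aestronglyMeasurable,
    ← coe_uniformPureState, integral_re_trace_mul_copies,
    meanCopies_uniformPureState, Matrix.mul_smul, copies_mul_boseProj, Matrix.trace_smul,
    ψ.trace_copies, smul_eq_mul, mul_one, ← Complex.ofReal_natCast, ← Complex.ofReal_inv,
    Complex.ofReal_re]

theorem integral_estimationPayoff_randomAxes {d R : ℕ} (S : Measurement d N R) (ψ : PureState d) :
    ∫ a, estimationPayoff d N a ψ ∂(randomAxes S : Measure (EstimationStrategy d N)) =
      ∫ U, estimationPayoff d N ⟨R, S.rotate U⟩ ψ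
        ∂(haarUnitary d : Measure (Matrix.unitaryGroup (Fin d) ℂ)) :=
  integral_map (measurable_rotate S).aemeasurable
    (measurable_estimationPayoff_left ψ).aestronglyMeasurable

theorem integrable_estimationPayoff_rotate {d R : ℕ} (S : Measurement d N R) (ψ : PureState d) :
    Integrable (fun U => estimationPayoff d N ⟨R, S.rotate U⟩ ψ)
      (haarUnitary d : Measure (Matrix.unitaryGroup (Fin d) ℂ)) := by
  have hm : Measurable fun U => estimationPayoff d N ⟨R, S.rotate U⟩ ψ :=
    (measurable_estimationPayoff_left ψ).comp (measurable_rotate S)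
  refine Integrable.of_bound hm.aestronglyMeasurable 1
    (Filter.Eventually.of_forall fun U => ?_)
  have h := estimationPayoff_mem_Icc ⟨R, S.rotate U⟩ ψ
  rw [Real.norm_eq_abs, abs_of_nonneg h.1]
  exact h.2

/-- Random axes guarantee the value of the estimation game against every state. -/
theorem IsCoherentMeasurement.le_integral_estimationPayoff {R : ℕ} {S : Measurement 2 N (R + 1)}
    (hS : IsCoherentMeasurement S) (ψ : PureState 2) :
    (boseDim 2 N : ℝ) / (boseDim 2 (N + 1) : ℝ) ≤
      ∫ a, estimationPayoff 2 N a ψ ∂(randomAxes S : Measure (EstimationStrategy 2 N)) := by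
  obtain ⟨c, -, hc1, hc⟩ := hS.exists_weights
  have hint := fun r : Fin R => (integrable_re_trace_mul_copies_act (ψ.copies (N + 1))
    (S.guess r.castSucc)).const_mul (c r)
  rw [integral_estimationPayoff_randomAxes]
  refine le_of_eq_of_le ?_ (integral_mono (integrable_finsetSum _ fun r _ => hint r)
    (integrable_estimationPayoff_rotate S ψ) (estimationPayoff_rotate_ge hc · ψ))
  rw [integral_finsetSum _ fun r _ => hint r]
  simp only [integral_const_mul, integral_re_trace_copies_mul_copies_act]
  -- The weights sum to N + 1 = d[N], and each term carries the factor 1/d[N+1].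
  rw [← Finset.sum_mul, hc1, div_eq_mul_inv, boseDim_two, Nat.cast_succ]

theorem isZeroSumNashEquilibrium_of_isCoherentMeasurement {R : ℕ} {S : Measurement 2 N (R + 1)}
    (hS : IsCoherentMeasurement S) (ψ₀ : PureState 2) :
    IsZeroSumNashEquilibrium (expectedPayoff (estimationPayoff 2 N)) (randomAxes S)
        (uniformPureState ψ₀) ∧
      expectedPayoff (estimationPayoff 2 N) (randomAxes S) (uniformPureState ψ₀) =
        ((N : ℝ) + 1) / ((N : ℝ) + 2) ∧
      HasValue (expectedPayoff (estimationPayoff 2 N)) (((N : ℝ) + 1) / ((N : ℝ) + 2)) := by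
  have hv : ((N : ℝ) + 1) / ((N : ℝ) + 2) = (boseDim 2 N : ℝ) / (boseDim 2 (N + 1) : ℝ) := by
    rw [boseDim_two, boseDim_two]
    push_cast
    ring
  rw [hv]
  exact isZeroSumNashEquilibrium_of_pure_bounds measurable_estimationPayoff
    (fun S ψ => (estimationPayoff_mem_Icc S ψ).1) (fun S ψ => (estimationPayoff_mem_Icc S ψ).2)
    (fun S => integral_estimationPayoff_le S ψ₀) hS.le_integral_estimationPayoff

/-! ### Spin states, coherent states and existence of the measurement -/

theorem card_filter_card_eq_choose (k : ℕ) :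
    (Finset.univ.filter fun i : Fin N → Fin 2 =>
      (Finset.univ.filter fun l => i l = 1).card = k).card = N.choose k := by
  rw [← Finset.card_fin N, ← Finset.card_powersetCard, Finset.card_fin]
  refine Finset.card_nbij' (fun i => Finset.univ.filter fun l => i l = 1)
    (fun s l => if l ∈ s then 1 else 0) ?_ ?_ ?_ ?_
  · intro i hi
    simpa [Finset.mem_powersetCard] using hi
  · intro s hs
    simpa [Finset.mem_powersetCard] using hs
  · intro i _
    funext l
    simp only [Finset.mem_filter, Finset.mem_univ, true_and]
    generalize i l = b
    fin_cases b <;> simp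
  · intro s _
    ext l
    simp

theorem star_spinState_dotProduct (k l : Fin (N + 1)) :
    star (spinState N k) ⬝ᵥ spinState N l = if k = l then 1 else 0 := by
  by_cases h : k = l
  · subst h
    have hk : (0 : ℝ) < N.choose k := by exact_mod_cast Nat.choose_pos (Nat.lt_succ_iff.mp k.2)
    have h1 : ∀ i, star (spinState N k i) * spinState N k i =
        if (Finset.univ.filter fun l => i l = 1).card = (k : ℕ) then
          ((N.choose k : ℝ)⁻¹ : ℂ) else 0 := by
      intro i
      unfold spinState
      split_ifs
      · rw [Complex.star_def, Complex.conj_ofReal, ← Complex.ofReal_mul, ← Complex.ofReal_inv,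
          div_mul_div_comm, Real.mul_self_sqrt hk.le, one_mul, one_div]
      · simp
    simp only [dotProduct, Pi.star_apply, h1]
    rw [← Finset.sum_filter, Finset.sum_const, card_filter_card_eq_choose, nsmul_eq_mul,
      Complex.ofReal_natCast, mul_inv_cancel₀ (by exact_mod_cast hk.ne')]
    simp
  · rw [if_neg h]
    refine Finset.sum_eq_zero fun i _ => ?_
    simp only [Pi.star_apply, spinState]
    split_ifs with h1 h2
    · exact absurd (Fin.ext (h1.symm.trans h2)) h
    all_goals simp

theorem boseProj_mulVec_spinState (k : Fin (N + 1)) :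
    boseProj 2 N *ᵥ spinState N k = spinState N k := by
  refine boseProj_mulVec_eq_self N fun π i => ?_
  have : (Finset.univ.filter fun l => (i ∘ π) l = 1).card =
      (Finset.univ.filter fun l => i l = 1).card :=
    Finset.card_equiv π (by simp)
  simp only [spinState, this]

/-- An entry of w^{⊗N} depends only on the number m of spins down, so only the term k = m
contributes; the root of the binomial coefficient in `wignerD` cancels the normalization of
`spinState`. -/
theorem tensorVec_eq_sum_coherentCoeff {w : Fin 2 → ℂ} {η θ : ℝ}
    (h0 : w 0 = Real.cos (θ / 2) * Complex.exp (-Complex.I * η / 2))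
    (h1 : w 1 = Real.sin (θ / 2) * Complex.exp (Complex.I * η / 2)) :
    tensorVec N w = ∑ k, coherentCoeff N η θ k • spinState N k := by
  ext i
  set m := (Finset.univ.filter fun l => i l = 1).card with hm
  have hmN : m ≤ N := by simpa using Finset.card_le_univ (Finset.univ.filter fun l => i l = 1)
  have hL : tensorVec N w i = w 0 ^ (N - m) * w 1 ^ m := by
    have h2 : ∀ k, w (i k) = if i k = 1 then w 1 else w 0 := by
      intro k
      generalize i k = b
      fin_cases b <;> simp
    have hcompl : (Finset.univ.filter fun l => ¬ i l = 1).card = N - m := by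
      have := Finset.card_filter_add_card_filter_not (s := Finset.univ) fun l => i l = 1
      rw [Finset.card_fin] at this
      omega
    rw [tensorVec, Finset.prod_congr rfl fun k _ => h2 k, Finset.prod_ite, Finset.prod_const,
      Finset.prod_const, hcompl, mul_comm]
  have hk : (0 : ℝ) < N.choose m := by exact_mod_cast Nat.choose_pos hmN
  rw [hL, Finset.sum_apply, Finset.sum_eq_single (⟨m, Nat.lt_succ_of_le hmN⟩ : Fin (N + 1))]
  · simp only [Pi.smul_apply, smul_eq_mul, spinState, ← hm, if_true, coherentCoeff, wignerD, spinM]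
    rw [h0, h1, mul_pow, mul_pow, ← Complex.exp_nat_mul, ← Complex.exp_nat_mul]
    -- Here N − m factors of phase −η/2 and m factors of phase η/2 combine to −η(N/2 − m).
    have he : Complex.exp (-Complex.I * η * (((N : ℝ) / 2 - (m : ℕ) : ℝ) : ℂ)) =
        Complex.exp (((N - m : ℕ) : ℂ) * (-Complex.I * η / 2)) *
          Complex.exp ((m : ℂ) * (Complex.I * η / 2)) := by
      rw [← Complex.exp_add, Nat.cast_sub hmN]
      congr 1
      push_cast
      ring
    rw [he]
    have hs : ((Real.sqrt (N.choose m) : ℝ) : ℂ) ≠ 0 := by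
      exact_mod_cast (Real.sqrt_pos.mpr hk).ne'
    push_cast
    field_simp
  · intro k _ hkm
    have : m ≠ (k : ℕ) := fun h => hkm (Fin.ext h.symm)
    simp [spinState, ← hm, this]
  · simp

/-- Every qubit is a rotated spin up state, up to a phase. -/
theorem exists_angles (φ : PureState 2) : ∃ (φ' : PureState 2) (η θ : ℝ),
    φ'.density = φ.density ∧
    (φ' : EuclideanSpace ℂ (Fin 2)).ofLp 0 =
      Real.cos (θ / 2) * Complex.exp (-Complex.I * η / 2) ∧
    (φ' : EuclideanSpace ℂ (Fin 2)).ofLp 1 =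
      Real.sin (θ / 2) * Complex.exp (Complex.I * η / 2) := by
  set v := (φ : EuclideanSpace ℂ (Fin 2)) with hv
  set α := (v.ofLp 0).arg
  set β := (v.ofLp 1).arg
  -- This global phase centres the arguments of the two components at ±(β − α)/2, as the symmetric
  -- form requires.
  set u := Complex.exp (-(((α + β) / 2 : ℝ) : ℂ) * Complex.I) with hu
  have hu1 : ‖u‖ = 1 := by
    rw [hu, ← Complex.ofReal_neg, Complex.norm_exp_ofReal_mul_I]
  -- The moduli are the coordinates of a point on the unit circle, whose argument is θ/2.
  set z : ℂ := ⟨‖v.ofLp 0‖, ‖v.ofLp 1‖⟩ with hz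
  have hz1 : ‖z‖ = 1 := by
    have h := EuclideanSpace.norm_sq_eq v
    rw [Fin.sum_univ_two, hv, norm_eq_of_mem_sphere φ] at h
    rw [← sq_eq_sq₀ (norm_nonneg _) zero_le_one, Complex.sq_norm, Complex.normSq_apply, h]
    simp only [hz, hv]
    ring
  have hcos := Complex.norm_mul_cos_arg z
  have hsin := Complex.norm_mul_sin_arg z
  rw [hz1, one_mul] at hcos hsin
  refine ⟨⟨u • v, ?_⟩, β - α, 2 * z.arg, ?_, ?_, ?_⟩
  · rw [mem_sphere_zero_iff_norm, norm_smul, hu1, one_mul]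
    exact norm_eq_of_mem_sphere φ
  · ext i j
    have huu : u * star u = 1 := by
      rw [Complex.star_def, Complex.mul_conj', hu1]; simp
    simp only [PureState.density, ketbra, Matrix.vecMulVec_apply, Pi.star_apply, PiLp.smul_apply,
      smul_eq_mul, star_mul']
    linear_combination v.ofLp i * star (v.ofLp j) * huu
  · rw [mul_div_cancel_left₀ _ two_ne_zero, hcos, PiLp.smul_apply, smul_eq_mul,
      ← Complex.norm_mul_exp_arg_mul_I (v.ofLp 0), hu]
    rw [mul_left_comm, ← Complex.exp_add]
    congr 2
    push_cast
    ring
  · rw [mul_div_cancel_left₀ _ two_ne_zero, hsin, PiLp.smul_apply, smul_eq_mul,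
      ← Complex.norm_mul_exp_arg_mul_I (v.ofLp 1), hu]
    rw [mul_left_comm, ← Complex.exp_add]
    congr 2
    push_cast
    ring

theorem exists_isCoherentMeasurement (N : ℕ) :
    ∃ (R : ℕ) (S : Measurement 2 N (R + 1)), IsCoherentMeasurement S := by
  let ψ₀ : PureState 2 := ⟨EuclideanSpace.single 0 1, by simp⟩
  obtain ⟨R, c, φ, hc, hsum⟩ := exists_sum_smul_copies_eq_boseProj N ψ₀
  choose φ' η θ hden h0 h1 using fun r => exists_angles (φ r)
  have hcop : ∀ r, (φ' r).copies N = (φ r).copies N := fun r => by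
    rw [PureState.copies, hden, PureState.copies]
  have htens := fun r => tensorVec_eq_sum_coherentCoeff (N := N) (h0 r) (h1 r)
  simp only [← hcop] at hsum
  -- The weighted copies sum to s_N, so the last effect is the projection onto the complement of the
  -- Bose space.
  let E : Fin (R + 1) → TensorOp 2 N :=
    Fin.snoc (fun r => (c r : ℂ) • (φ' r).copies N) (1 - boseProj 2 N)
  refine ⟨R, ⟨(E, Fin.snoc φ' ψ₀), fun r => ?_, ?_⟩, c, η, θ, hc, fun k l => ?_, fun r => ?_,
    fun r => ?_⟩
  · refine Fin.lastCases ?_ (fun r => ?_) r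
    · simpa [E] using posSemidef_one_sub_projection (isHermitian_boseProj N) (boseProj_mul_self N)
    · simpa [E] using ((φ' r).posSemidef_copies N).smul
        (Complex.zero_le_real.mpr (hc r))
  · rw [Fin.sum_univ_castSucc]
    simp only [E, Fin.snoc_castSucc, Fin.snoc_last, hsum, add_sub_cancel]
  · have hover : ∀ r k, star (spinState N k) ⬝ᵥ
        tensorVec N (φ' r : EuclideanSpace ℂ (Fin 2)).ofLp = coherentCoeff N (η r) (θ r) k := by
      intro r k
      rw [htens, dotProduct_sum]
      simp [dotProduct_smul, star_spinState_dotProduct]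
    have hr : ∀ r, star (spinState N k) ⬝ᵥ (((c r : ℂ) • (φ' r).copies N) *ᵥ spinState N l) =
        effectCoeff N (c r) (η r) (θ r) k l := by
      intro r
      rw [PureState.copies_eq_ketbra, ketbra, Matrix.smul_mulVec, Matrix.vecMulVec_mulVec,
        dotProduct_smul, dotProduct_smul, hover, effectCoeff_eq, ← hover r l,
        ← Matrix.star_dotProduct]
      simp
    -- Completeness is read off from the matrix elements ⟨m|s_N|n⟩ = δ between spin states, after
    -- expanding s_N.
    rw [← star_spinState_dotProduct, ← boseProj_mulVec_spinState l, ← hsum, Matrix.sum_mulVec,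
      dotProduct_sum]
    simp only [hr]
  · have hE : E r.castSucc = (c r : ℂ) • (φ' r).copies N := by simp [E]
    exact hE.trans (sum_effectCoeff_smul _ _ _ _ (htens r)).symm
  · have hg : (Fin.snoc φ' ψ₀ : Fin (R + 1) → PureState 2) r.castSucc = φ' r := by simp
    change tensorVec N ((Fin.snoc φ' ψ₀ : Fin (R + 1) → PureState 2) r.castSucc :
      EuclideanSpace ℂ (Fin 2)).ofLp = _
    rw [hg]
    exact htens r

end Qubits

/-! ### Channels in Kraus form -/

section Kraus

variable {m n ι : Type*} [Fintype m] [Fintype ι]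

/-- The completely positive map `X ↦ ∑ₐ Kₐ X Kₐ†`. -/
def krausMap (K : ι → Matrix n m ℂ) : Matrix m m ℂ →ₗ[ℂ] Matrix n n ℂ where
  toFun X := ∑ a, K a * X * (K a)ᴴ
  map_add' X Y := by simp [Matrix.mul_add, Matrix.add_mul, Finset.sum_add_distrib]
  map_smul' c X := by simp [Finset.smul_sum]

theorem krausMap_apply (K : ι → Matrix n m ℂ) (X : Matrix m m ℂ) :
    krausMap K X = ∑ a, K a * X * (K a)ᴴ := rfl

theorem one_kronecker_mul_mul_apply {k : Type*} [Fintype k] [DecidableEq k] (A : Matrix n m ℂ)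
    (X : Matrix (k × m) (k × m) ℂ) (p q : k × n) :
    (((1 : Matrix k k ℂ) ⊗ₖ A) * X * ((1 : Matrix k k ℂ) ⊗ₖ A)ᴴ) p q =
      (A * (Matrix.of fun i j => X (p.1, i) (q.1, j)) * Aᴴ) p.2 q.2 := by
  simp only [Matrix.mul_apply, Matrix.kroneckerMap_apply, Matrix.conjTranspose_apply,
    Fintype.sum_prod_type, Matrix.one_apply, Matrix.of_apply, ite_mul, one_mul, zero_mul]
  rw [Finset.sum_eq_single q.1 (fun b _ hb => by simp [hb.symm]) (by simp)]
  refine Finset.sum_congr rfl fun j _ => ?_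
  rw [Finset.sum_eq_single p.1 (fun b _ hb => by simp [hb.symm]) (by simp)]
  simp

/-- The channel with the Kraus operators `Kₐ`. -/
def Channel.ofKraus [Fintype n] (K : ι → Matrix n m ℂ) (h : ∀ X, (krausMap K X).trace = X.trace) :
    Channel m n where
  map := krausMap K
  trace_map := h
  completelyPositive k X hX := by
    have h1 : (Matrix.of fun (p q : Fin k × n) =>
        krausMap K (Matrix.of fun i j => X (p.1, i) (q.1, j)) p.2 q.2) =
        ∑ a, ((1 : Matrix (Fin k) (Fin k) ℂ) ⊗ₖ K a) * X *
          ((1 : Matrix (Fin k) (Fin k) ℂ) ⊗ₖ K a)ᴴ := by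
      ext p q
      rw [Matrix.of_apply, krausMap_apply, Matrix.sum_apply, Matrix.sum_apply]
      exact Finset.sum_congr rfl fun a _ => (one_kronecker_mul_mul_apply (K a) X p q).symm
    rw [h1]
    exact Matrix.posSemidef_sum _ fun a _ => hX.mul_mul_conjTranspose_same _

end Kraus

/-! ### The optimal cloner -/

section Cloner

variable {d N K : ℕ}

/-- The isometry `v ↦ v ⊗ e_j`. -/
def appendBasis (d N : ℕ) {K : ℕ} (j : Fin K → Fin d) :
    Matrix (Fin (N + K) → Fin d) (Fin N → Fin d) ℂ :=
  Matrix.of fun i a => if i = Fin.appendEquiv N K (a, j) then 1 else 0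

/-- Appending each basis word in turn gives a Kraus form of X ↦ X ⊗ 1. -/
theorem sum_appendBasis_mul_mul (X : TensorOp d N) :
    ∑ j : Fin K → Fin d, appendBasis d N j * X * (appendBasis d N j)ᴴ = tensorMul X 1 := by
  ext i i'
  obtain ⟨⟨a, b⟩, rfl⟩ := (Fin.appendEquiv N K).surjective i
  obtain ⟨⟨a', b'⟩, rfl⟩ := (Fin.appendEquiv N K).surjective i'
  rw [tensorMul, Matrix.submatrix_apply, Equiv.symm_apply_apply, Equiv.symm_apply_apply,
    Matrix.kroneckerMap_apply, Matrix.one_apply, Matrix.sum_apply]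
  simp only [Matrix.mul_apply, appendBasis, Matrix.conjTranspose_apply, Matrix.of_apply,
    EmbeddingLike.apply_eq_iff_eq, Prod.mk.injEq, ite_and, ite_mul, one_mul, zero_mul,
    apply_ite (star : ℂ → ℂ),
    star_one, star_zero, mul_ite, mul_one, mul_zero]
  simp

/-- The partial trace of s_{N+K} is a multiple of s_N. In place of combinatorics, the identity tr((X
⊗ 1) ψ^{⊗(N+K)}) = tr(X ψ^{⊗N}) is averaged over ψ. -/
theorem trace_tensorMul_one_mul_boseProj (ψ₀ : PureState d) (X : TensorOp d N) :
    (tensorMul X (1 : TensorOp d K) * boseProj d (N + K)).trace =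
      (boseDim d (N + K) : ℂ) / boseDim d N * (X * boseProj d N).trace := by
  have h1 := integral_trace_mul_copies (N + K) (uniformPureState ψ₀ : Measure (PureState d))
    (tensorMul X (1 : TensorOp d K))
  have h2 := integral_trace_mul_copies N (uniformPureState ψ₀ : Measure (PureState d)) X
  have h3 : ∀ ψ : PureState d, (tensorMul X (1 : TensorOp d K) * ψ.copies (N + K)).trace =
      (X * ψ.copies N).trace := fun ψ => by
    rw [ψ.copies_add, tensorMul_mul_tensorMul, trace_tensorMul, one_mul, ψ.trace_copies, mul_one]
  simp only [h3] at h1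
  rw [h2, meanCopies_uniformPureState, meanCopies_uniformPureState, Matrix.mul_smul,
    Matrix.mul_smul, Matrix.trace_smul, Matrix.trace_smul, smul_eq_mul, smul_eq_mul] at h1
  have hd := boseDim_ne_zero (N := N + K) ψ₀
  rw [div_mul_eq_mul_div, div_eq_inv_mul, mul_left_comm, h1, mul_inv_cancel_left₀ hd]

theorem sum_vecMulVec_single_mul_mul {m n : Type*} [Fintype m] [DecidableEq m]
    (u : n → ℂ) (X : Matrix m m ℂ) :
    ∑ a, Matrix.vecMulVec u (Pi.single a 1 : m → ℂ) * X *
      (Matrix.vecMulVec u (Pi.single a 1 : m → ℂ))ᴴ =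
      X.trace • ketbra u := by
  have h : ∀ a, Matrix.vecMulVec u (Pi.single a 1 : m → ℂ) * X *
      (Matrix.vecMulVec u (Pi.single a 1 : m → ℂ))ᴴ = X a a • ketbra u := fun a => by
    rw [Matrix.vecMulVec_mul, Matrix.conjTranspose_vecMulVec, Matrix.vecMulVec_mul_vecMulVec,
      ketbra]
    ext i j
    simp [Matrix.vecMulVec_apply, mul_left_comm]
  simp only [h, ← Finset.sum_smul]
  rfl

/-- The Kraus operators of the optimal cloner: those acting on the Bose space, and those preparing
copies of `ψ₀` out of its complement. -/
def clonerKraus (d N K : ℕ) (ψ₀ : PureState d) :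
    (Fin K → Fin d) ⊕ (Fin N → Fin d) → Matrix (Fin (N + K) → Fin d) (Fin N → Fin d) ℂ
  | .inl j => (Real.sqrt ((boseDim d N : ℝ) / boseDim d (N + K)) : ℂ) •
      (boseProj d (N + K) * appendBasis d N j * boseProj d N)
  | .inr a => Matrix.vecMulVec (tensorVec (N + K) (ψ₀ : EuclideanSpace ℂ (Fin d)).ofLp)
      (Pi.single a 1) * (1 - boseProj d N)

theorem krausMap_clonerKraus (ψ₀ : PureState d) (X : TensorOp d N) :
    krausMap (clonerKraus d N K ψ₀) X = ((boseDim d N : ℂ) / boseDim d (N + K)) •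
        (boseProj d (N + K) * tensorMul (boseProj d N * X * boseProj d N) 1 *
          boseProj d (N + K)) +
      ((1 - boseProj d N) * X * (1 - boseProj d N)).trace • ψ₀.copies (N + K) := by
  rw [krausMap_apply, Fintype.sum_sum_type, ψ₀.copies_eq_ketbra, ← sum_vecMulVec_single_mul_mul,
    ← sum_appendBasis_mul_mul, Finset.mul_sum, Finset.sum_mul, Finset.smul_sum]
  have hs : (Real.sqrt ((boseDim d N : ℝ) / boseDim d (N + K)) : ℂ) *
      (Real.sqrt ((boseDim d N : ℝ) / boseDim d (N + K)) : ℂ) =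
      (boseDim d N : ℂ) / boseDim d (N + K) := by
    rw [← Complex.ofReal_mul, Real.mul_self_sqrt (by positivity)]
    push_cast
    rfl
  have hQ : (1 - boseProj d N)ᴴ = 1 - boseProj d N :=
    Matrix.isHermitian_one.sub (isHermitian_boseProj N)
  congr 1
  · refine Finset.sum_congr rfl fun j _ => ?_
    simp only [clonerKraus, Matrix.conjTranspose_smul, Matrix.conjTranspose_mul, Matrix.smul_mul,
      Matrix.mul_smul, smul_smul, Complex.star_def, Complex.conj_ofReal, hs,
      (isHermitian_boseProj _).eq, Matrix.mul_assoc]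
  · refine Finset.sum_congr rfl fun a _ => ?_
    simp only [clonerKraus, Matrix.conjTranspose_mul, hQ, Matrix.mul_assoc]

/-- The two families of Kraus operators account for the parts of the trace on the Bose space and on
its complement; the factor d[N]/d[N+K] cancels the one from the partial trace. -/
theorem trace_krausMap_clonerKraus (ψ₀ : PureState d) (X : TensorOp d N) :
    (krausMap (clonerKraus d N K ψ₀) X).trace = X.trace := by
  have hN := boseDim_ne_zero (N := N) ψ₀
  have hM := boseDim_ne_zero (N := N + K) ψ₀
  have h1 : (boseProj d N * X * boseProj d N).trace = (X * boseProj d N).trace := by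
    rw [mul_assoc, Matrix.trace_mul_comm, mul_assoc, boseProj_mul_self]
  have h2 : ((1 - boseProj d N) * X * (1 - boseProj d N)).trace =
      X.trace - (X * boseProj d N).trace := by
    have hQ : (1 - boseProj d N) * (1 - boseProj d N) = 1 - boseProj d N := by
      simp [mul_sub, sub_mul, boseProj_mul_self]
    rw [mul_assoc, Matrix.trace_mul_comm, mul_assoc, hQ, mul_sub, mul_one, Matrix.trace_sub]
  rw [krausMap_clonerKraus, Matrix.trace_add, Matrix.trace_smul, Matrix.trace_smul,
    ψ₀.trace_copies, mul_assoc (boseProj d (N + K)), Matrix.trace_mul_comm, mul_assoc,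
    boseProj_mul_self, trace_tensorMul_one_mul_boseProj ψ₀, mul_assoc _ (boseProj d N),
    boseProj_mul_self, h1, h2, smul_eq_mul, smul_eq_mul, ← mul_assoc, div_mul_div_cancel₀ hM,
    div_self hN]
  ring

theorem exists_isWernerCloner {M : ℕ} (hd : 1 ≤ d) (h : N ≤ M) :
    ∃ T : CloningStrategy d N M, IsWernerCloner h T := by
  obtain ⟨K, rfl⟩ := Nat.exists_eq_add_of_le h
  let ψ₀ : PureState d := ⟨EuclideanSpace.single ⟨0, hd⟩ 1, by simp⟩
  refine ⟨Channel.ofKraus (clonerKraus d N K ψ₀) (trace_krausMap_clonerKraus ψ₀), fun ρ hρ => ?_⟩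
  -- The preparation branch does nothing to operators supported on the Bose space.
  have h0 : (1 - boseProj d N) * ρ = 0 := by
    rw [← hρ, ← mul_assoc, ← mul_assoc, sub_mul, one_mul, boseProj_mul_self, sub_self, zero_mul,
      zero_mul]
  change krausMap (clonerKraus d N K ψ₀) ρ = _
  rw [krausMap_clonerKraus, hρ, h0, zero_mul, Matrix.trace_zero, zero_smul, add_zero,
    tensorIdentity_eq_tensorMul]

end Cloner

end QuantumGames

end

/-! ### Equilibria and values of both games -/

theorem mainTheorem4 :
    -- the state estimation game with `N` qubits
    (∀ N : ℕ,
      (∃ (R : ℕ) (S : QuantumGames.Measurement 2 N (R + 1)),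
        QuantumGames.IsCoherentMeasurement S) ∧
      (∀ (R : ℕ) (S : QuantumGames.Measurement 2 N (R + 1)),
        QuantumGames.IsCoherentMeasurement S →
        ∀ ψ₀ : QuantumGames.PureState 2,
          QuantumGames.IsZeroSumNashEquilibrium
            (QuantumGames.expectedPayoff (QuantumGames.estimationPayoff 2 N))
            (QuantumGames.randomAxes S) (QuantumGames.uniformPureState ψ₀) ∧
          QuantumGames.expectedPayoff (QuantumGames.estimationPayoff 2 N)
            (QuantumGames.randomAxes S) (QuantumGames.uniformPureState ψ₀)
              = ((N : ℝ) + 1) / ((N : ℝ) + 2)) ∧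
      QuantumGames.HasValue
        (QuantumGames.expectedPayoff (QuantumGames.estimationPayoff 2 N))
        (((N : ℝ) + 1) / ((N : ℝ) + 2))) ∧
    -- the `N ↦ M` cloning game in dimension `d`
    (∀ (d N M : ℕ) (_hd : 1 ≤ d) (hNM : N ≤ M),
      (∃ T : QuantumGames.CloningStrategy d N M, QuantumGames.IsWernerCloner hNM T) ∧
      (∀ T : QuantumGames.CloningStrategy d N M, QuantumGames.IsWernerCloner hNM T →
        ∀ ψ₀ : QuantumGames.PureState d,
          QuantumGames.IsZeroSumNashEquilibrium
            (QuantumGames.expectedPayoff (QuantumGames.cloningPayoff d N M))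
            (QuantumGames.pureAsMixed T) (QuantumGames.uniformPureState ψ₀) ∧
          QuantumGames.expectedPayoff (QuantumGames.cloningPayoff d N M)
            (QuantumGames.pureAsMixed T) (QuantumGames.uniformPureState ψ₀)
              = (QuantumGames.boseDim d N : ℝ) / (QuantumGames.boseDim d M : ℝ)) ∧
      QuantumGames.HasValue
        (QuantumGames.expectedPayoff (QuantumGames.cloningPayoff d N M))
        ((QuantumGames.boseDim d N : ℝ) / (QuantumGames.boseDim d M : ℝ))) := by
  refine ⟨fun N => ?_, fun d N M hd hNM => ?_⟩
  -- The value does not refer to any measurement, so an existing one is needed to certify it; the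
  -- same holds for the cloner below.
  · obtain ⟨R, S, hS⟩ := QuantumGames.exists_isCoherentMeasurement N
    refine ⟨⟨R, S, hS⟩, fun R S hS ψ₀ => ?_, ?_⟩
    · have h := QuantumGames.isZeroSumNashEquilibrium_of_isCoherentMeasurement hS ψ₀
      exact ⟨h.1, h.2.1⟩
    · exact (QuantumGames.isZeroSumNashEquilibrium_of_isCoherentMeasurement hS
        ⟨EuclideanSpace.single 0 1, by simp⟩).2.2
  · obtain ⟨T, hT⟩ := QuantumGames.exists_isWernerCloner hd hNM
    refine ⟨⟨T, hT⟩, fun T hT ψ₀ => ?_, ?_⟩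
    · have h := QuantumGames.isZeroSumNashEquilibrium_of_isWernerCloner hT ψ₀
      exact ⟨h.1, h.2.1⟩
    · exact (QuantumGames.isZeroSumNashEquilibrium_of_isWernerCloner hT
        ⟨EuclideanSpace.single ⟨0, hd⟩ 1, by simp⟩).2.2
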